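/- Let $a_0\in\mathbb R$ and let $b:\mathbb R\to\mathbb R$ be Lipschitz continuous in a neighbourhood of $a_0$ with $b(a_0)\neq 0$. For $f\in L^2(\mathbb R)$ let $\hat f$ be its unitary Fourier transform, i.e. the $L^2$-extension of $\hat f(v)=\frac1{\sqrt{2\pi}}\int_{\mathbb R}e^{-ivt}f(t)\,dt$, and for $a,u\in\mathbb R$ put $$L_af(u)=\frac1{\sqrt{2\pi}}\int_{\mathbb R}e^{i[b(a)uv+av^2]}\hat f(v)\,dv:=\lim_{N\to+\infty}\frac1{\sqrt{2\pi}}\int_{-N}^{N}e^{i[b(a)uv+av^2]}\hat f(v)\,dv$$ whenever this limit exists. Let $s\ge\frac14$ and let $f\in H^s(\mathbb R)$, i.e. $f\in L^2(\mathbb R)$ and $(1+v^2)^{s/2}\hat f(v)\in L^2(\mathbb R)$. Then for almost every $u\in\mathbb R$, the limit defining $L_af(u)$ exists for all $a$ in a neighbourhood of $a_0$ (including $a=a_0$), and $$\lim_{a\to a_0}L_af(u)=L_{a_0}f(u).$$ -/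

import Mathlib

open MeasureTheory Filter Topology FourierTransform
open scoped SchwartzMap

noncomputable section

/-- The unitary Fourier transform in angular frequency on `L²(ℝ)`: the continuous extension of
`f ↦ (v ↦ (2π)^(-1/2) ∫ e^(-ivt) f(t) dt)`. Mathlib's `𝓕` uses the kernel `e^(-2πivt)`, hence the
rescaling. -/
def angularFourier (f : Lp ℂ 2 (volume : Measure ℝ)) (v : ℝ) : ℂ :=
  ((Real.sqrt (2 * Real.pi) : ℝ) : ℂ)⁻¹ *
    (𝓕 f : Lp ℂ 2 (volume : Measure ℝ)) (v / (2 * Real.pi))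

/-- Truncation to frequencies `|v| ≤ N`:
`(2π)^(-1/2) ∫_{-N}^{N} e^(i(b(a)uv + av²)) f̂(v) dv`. The integrand is integrable, since `f̂` is
square integrable. -/
def truncatedL (b : ℝ → ℝ) (f : Lp ℂ 2 (volume : Measure ℝ)) (a u N : ℝ) : ℂ :=
  ((Real.sqrt (2 * Real.pi) : ℝ) : ℂ)⁻¹ *
    ∫ v in (-N)..N,
      Complex.exp (Complex.I * ((b a * u * v + a * v ^ 2 : ℝ) : ℂ)) * angularFourier f v

/-- `L_a f(u) = (2π)^(-1/2) ∫ e^(i(b(a)uv + av²)) f̂(v) dv`, the integral over `ℝ` being the limit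
of the integrals over `[-N, N]` (for `f ∈ L²` the function `f̂` need not be integrable).
It is meaningful only where this limit exists. -/
def operatorL (b : ℝ → ℝ) (f : Lp ℂ 2 (volume : Measure ℝ)) (a u : ℝ) : ℂ :=
  limUnder atTop (fun N : ℝ => truncatedL b f a u N)

end

/-! This is a Kolmogorov–Seliverstov–Plessner argument. With `g` the density `f̂` (up to a constant)
and `V` a neighbourhood of `a₀` on which `b` is Lipschitz and bounded away from `0`, the supremum
over `a ∈ V` and all truncations `N` of the truncated integrals is bounded in `L²([-R, R])` by `∫
|g|² (1 + |v|)^(1/2)`, which is finite for `f ∈ H^(1/4)`.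

To prove the bound, let `a` and `N` be measurable functions of `u` and apply `TT*` with weight `(1 +
|v|)^(-1/2)` (`integral_norm_sq_integral_kernel_le`). The kernel is a symmetric integral of `e^(i(xv
+ tv²)) (1 + |v|)^(-1/2)` with `x = βu - β'u'` and `t = α - α'`. Uniformly in the truncation it is
`O(|x|^(-1/2))` and `O(|t|^(-1/4))` (`norm_integral_symm_le_left`, `norm_integral_symm_le_right`).
Either `|x| ≳ |u - u'|`, or the Lipschitz condition forces `|t| ≳ |u - u'|`. In both cases the
kernel is `O(|u - u'|^(-1/2))` on `[-R, R]`, so Schur's test applies (`exists_linearized_bound`).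

Applied to the high frequencies of `g`, the maximal estimate shows that for almost every `u` the
truncated integrals are Cauchy uniformly in `a ∈ V` (`ae_uniform_tail_le`). They are continuous in
`a`, hence so is their uniform limit. -/

/-- The quadratic oscillation `e^(i(xv + tv²))`. -/
noncomputable def quadExp (x t v : ℝ) : ℂ :=
  Complex.exp (Complex.I * ((x * v + t * v ^ 2 : ℝ) : ℂ))

theorem norm_quadExp (x t v : ℝ) : ‖quadExp x t v‖ = 1 := by
  rw [quadExp, mul_comm, Complex.norm_exp_ofReal_mul_I]

theorem quadExp_neg (x t v : ℝ) : quadExp x t (-v) = quadExp (-x) t v := by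
  simp [quadExp]

theorem conj_quadExp (x t v : ℝ) :
    (starRingEnd ℂ) (quadExp x t v) = quadExp (-x) (-t) v := by
  rw [quadExp, quadExp, ← Complex.exp_conj]
  congr 1
  simp
  ring

theorem quadExp_mul (x t x' t' v : ℝ) :
    quadExp x t v * quadExp x' t' v = quadExp (x + x') (t + t') v := by
  rw [quadExp, quadExp, quadExp, ← Complex.exp_add]
  congr 1
  push_cast
  ring

theorem hasDerivAt_quadExp (x t v : ℝ) :
    HasDerivAt (quadExp x t) (Complex.I * ((x + 2 * t * v : ℝ) : ℂ) * quadExp x t v) v := by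
  have h1 : HasDerivAt (fun v : ℝ => x * v + t * v ^ 2) (x + 2 * t * v) v := by
    have := ((hasDerivAt_id v).const_mul x).add ((hasDerivAt_pow 2 v).const_mul t)
    refine this.congr_deriv ?_
    simp only [Nat.cast_ofNat, Nat.add_one_sub_one, pow_one]
    ring
  have h2 := (h1.ofReal_comp.const_mul Complex.I).cexp
  refine h2.congr_deriv ?_
  rw [quadExp]
  ring

theorem continuous_quadExp (x t : ℝ) : Continuous (quadExp x t) := by
  unfold quadExp; fun_prop

/-! ### Integration by parts and van der Corput estimates -/

/-- If `c` lies outside `[p, q]`, one of the two pieces is the whole interval. Later cuts therefore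
need no discussion of where the cutting point falls. -/
theorem norm_integral_le_of_split {f : ℝ → ℂ} (hf : Continuous f) {p q c B₁ B₂ : ℝ} (hpq : p ≤ q)
    (hB₁ : 0 ≤ B₁) (hB₂ : 0 ≤ B₂)
    (h₁ : ∀ r, p ≤ r → r ≤ q → r ≤ c → ‖∫ v in p..r, f v‖ ≤ B₁)
    (h₂ : ∀ r, p ≤ r → r ≤ q → c ≤ r → ‖∫ v in r..q, f v‖ ≤ B₂) :
    ‖∫ v in p..q, f v‖ ≤ B₁ + B₂ := by
  rcases le_total c p with h | h
  · linarith [h₂ p le_rfl hpq h]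
  rcases le_total q c with h' | h'
  · linarith [h₁ q hpq le_rfl h']
  rw [← intervalIntegral.integral_add_adjacent_intervals (hf.intervalIntegrable p c)
    (hf.intervalIntegrable c q)]
  exact (norm_add_le _ _).trans (add_le_add (h₁ c h h' le_rfl) (h₂ c h h' le_rfl))

/-- Integrate by parts against the primitive of `F`: the boundary term costs `M * ρ q`, the decrease
of `ρ` costs `M * (ρ p - ρ q)`, and these add up to `M * ρ p`. -/
theorem norm_integral_mul_antitone_le {F : ℝ → ℂ} (hF : Continuous F) {ρ ρ' : ℝ → ℝ} {p q M : ℝ}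
    (hpq : p ≤ q) (hρ : ∀ v ∈ Set.Icc p q, HasDerivAt ρ (ρ' v) v)
    (hc : ContinuousOn ρ' (Set.Icc p q)) (hneg : ∀ v ∈ Set.Icc p q, ρ' v ≤ 0) (hq : 0 ≤ ρ q)
    (hM : ∀ r ∈ Set.Icc p q, ‖∫ v in p..r, F v‖ ≤ M) :
    ‖∫ v in p..q, F v * (ρ v : ℂ)‖ ≤ M * ρ p := by
  have huIcc : Set.uIcc p q = Set.Icc p q := Set.uIcc_of_le hpq
  have hint : IntervalIntegrable ρ' volume p q := by
    apply ContinuousOn.intervalIntegrable; rwa [huIcc]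
  have key := intervalIntegral.integral_mul_deriv_eq_deriv_mul (a := p) (b := q)
    (u := fun v => (ρ v : ℂ)) (u' := fun v => (ρ' v : ℂ)) (v := fun r => ∫ v in p..r, F v) (v' := F)
    (fun v hv => (hρ v (huIcc ▸ hv)).ofReal_comp)
    (fun v _ => intervalIntegral.integral_hasDerivAt_right (hF.intervalIntegrable _ _)
      (hF.stronglyMeasurableAtFilter _ _) hF.continuousAt)
    ⟨hint.1.ofReal, hint.2.ofReal⟩ (hF.intervalIntegrable _ _)
  have e : ∫ v in p..q, F v * (ρ v : ℂ) = ∫ v in p..q, (ρ v : ℂ) * F v := by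
    simp only [mul_comm]
  rw [e, key, intervalIntegral.integral_same, mul_zero, sub_zero]
  have h1 : ‖(ρ q : ℂ) * ∫ v in p..q, F v‖ ≤ ρ q * M := by
    rw [norm_mul, Complex.norm_real, Real.norm_of_nonneg hq]
    exact mul_le_mul_of_nonneg_left (hM q ⟨hpq, le_rfl⟩) hq
  have h2 : ‖∫ v in p..q, (ρ' v : ℂ) * ∫ w in p..v, F w‖ ≤ ∫ v in p..q, -ρ' v * M := by
    refine intervalIntegral.norm_integral_le_of_norm_le hpq ?_ (hint.neg.mul_const M)
    refine Filter.Eventually.of_forall fun v hv => ?_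
    have hv' : v ∈ Set.Icc p q := ⟨hv.1.le, hv.2⟩
    rw [norm_mul, Complex.norm_real, Real.norm_of_nonpos (hneg v hv')]
    exact mul_le_mul_of_nonneg_left (hM v hv') (by linarith [hneg v hv'])
  have h3 : ∫ v in p..q, -ρ' v * M = (ρ p - ρ q) * M := by
    rw [intervalIntegral.integral_mul_const, intervalIntegral.integral_neg,
      intervalIntegral.integral_eq_sub_of_hasDerivAt (fun v hv => hρ v (huIcc ▸ hv)) hint]
    ring
  calc _ ≤ _ := norm_sub_le _ _
    _ ≤ ρ q * M + (ρ p - ρ q) * M := add_le_add h1 (h2.trans h3.le)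
    _ = M * ρ p := by ring

/-- First derivative test. -/
theorem norm_integral_quadExp_le_of_le_deriv {x t p q l : ℝ} (hpq : p ≤ q) (hl : 0 < l)
    (h : ∀ v ∈ Set.Icc p q, l ≤ |x + 2 * t * v|) :
    ‖∫ v in p..q, quadExp x t v‖ ≤ 4 / l := by
  have huIcc : Set.uIcc p q = Set.Icc p q := Set.uIcc_of_le hpq
  have hne : ∀ v ∈ Set.Icc p q, x + 2 * t * v ≠ 0 := fun v hv h0 => by
    have := h v hv
    rw [h0, abs_zero] at this
    linarith
  have hd : ∀ v ∈ Set.Icc p q, HasDerivAt (fun v => (x + 2 * t * v)⁻¹)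
      (-(2 * t) / (x + 2 * t * v) ^ 2) v := fun v hv => by
    have h1 : HasDerivAt (fun v : ℝ => x + 2 * t * v) (2 * t) v := by
      simpa using ((hasDerivAt_id v).const_mul (2 * t)).const_add x
    exact h1.inv (hne v hv)
  have hcont : ContinuousOn (fun v => -(2 * t) / (x + 2 * t * v) ^ 2) (Set.Icc p q) := by
    apply ContinuousOn.div (by fun_prop) (by fun_prop)
    exact fun v hv => pow_ne_zero 2 (hne v hv)
  have hint : IntervalIntegrable (fun v => -(2 * t) / (x + 2 * t * v) ^ 2) volume p q := by
    apply ContinuousOn.intervalIntegrable; rwa [huIcc]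
  have hle : ∀ v ∈ Set.Icc p q, |(x + 2 * t * v)⁻¹| ≤ 1 / l := fun v hv => by
    rw [abs_inv, ← one_div]
    exact one_div_le_one_div_of_le hl (h v hv)
  have key := intervalIntegral.integral_mul_deriv_eq_deriv_mul (a := p) (b := q)
    (u := fun v => (((x + 2 * t * v)⁻¹ : ℝ) : ℂ))
    (u' := fun v => ((-(2 * t) / (x + 2 * t * v) ^ 2 : ℝ) : ℂ))
    (v := quadExp x t) (v' := fun v => Complex.I * ((x + 2 * t * v : ℝ) : ℂ) * quadExp x t v)
    (fun v hv => (hd v (huIcc ▸ hv)).ofReal_comp)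
    (fun v _ => hasDerivAt_quadExp x t v) ⟨hint.1.ofReal, hint.2.ofReal⟩
    (Continuous.intervalIntegrable (by have := continuous_quadExp x t; fun_prop) _ _)
  have e : ∫ v in p..q, (((x + 2 * t * v)⁻¹ : ℝ) : ℂ) *
      (Complex.I * ((x + 2 * t * v : ℝ) : ℂ) * quadExp x t v) =
      Complex.I * ∫ v in p..q, quadExp x t v := by
    rw [← intervalIntegral.integral_const_mul]
    refine intervalIntegral.integral_congr fun v hv => ?_
    have h0 : ((x + 2 * t * v : ℝ) : ℂ) ≠ 0 := Complex.ofReal_ne_zero.2 (hne v (huIcc ▸ hv))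
    simp only [Complex.ofReal_inv]
    field_simp
  have hnorm : ‖∫ v in p..q, quadExp x t v‖ =
      ‖Complex.I * ∫ v in p..q, quadExp x t v‖ := by simp
  rw [hnorm, ← e, key]
  have hb : ∀ v ∈ Set.Icc p q, ‖(((x + 2 * t * v)⁻¹ : ℝ) : ℂ) * quadExp x t v‖ ≤ 1 / l :=
    fun v hv => by
      rw [norm_mul, norm_quadExp, mul_one, Complex.norm_real]; exact hle v hv
  have h2 : ‖∫ v in p..q, ((-(2 * t) / (x + 2 * t * v) ^ 2 : ℝ) : ℂ) * quadExp x t v‖ ≤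
      |∫ v in p..q, -(2 * t) / (x + 2 * t * v) ^ 2| := by
    have hs : ‖∫ v in p..q, ((-(2 * t) / (x + 2 * t * v) ^ 2 : ℝ) : ℂ) * quadExp x t v‖ ≤
        ∫ v in p..q, |-(2 * t) / (x + 2 * t * v) ^ 2| := by
      refine intervalIntegral.norm_integral_le_of_norm_le hpq ?_ hint.abs
      refine Filter.Eventually.of_forall fun v _ => ?_
      rw [norm_mul, norm_quadExp, mul_one, Complex.norm_real, Real.norm_eq_abs]
    refine hs.trans ?_
    -- The derivative of `(x + 2tv)⁻¹` has constant sign, so its total variation is the difference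
    -- of its endpoint values.
    rcases le_total 0 t with ht | ht
    · have : ∀ v, |-(2 * t) / (x + 2 * t * v) ^ 2| = -(-(2 * t) / (x + 2 * t * v) ^ 2) := fun v =>
        abs_of_nonpos (div_nonpos_of_nonpos_of_nonneg (by linarith) (sq_nonneg _))
      simp only [this]
      rw [intervalIntegral.integral_neg]
      exact neg_le_abs _
    · have : ∀ v, |-(2 * t) / (x + 2 * t * v) ^ 2| = -(2 * t) / (x + 2 * t * v) ^ 2 := fun v =>
        abs_of_nonneg (div_nonneg (by linarith) (sq_nonneg _))
      simp only [this]
      exact le_abs_self _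
  rw [intervalIntegral.integral_eq_sub_of_hasDerivAt (fun v hv => hd v (huIcc ▸ hv)) hint] at h2
  have hp := hle p ⟨le_rfl, hpq⟩
  have hq := hle q ⟨hpq, le_rfl⟩
  have h3 := h2.trans (abs_sub _ _)
  have hp' := hb p ⟨le_rfl, hpq⟩
  have hq' := hb q ⟨hpq, le_rfl⟩
  have e4 : 4 / l = 1 / l + 1 / l + (1 / l + 1 / l) := by ring
  rw [e4]
  exact (norm_sub_le _ _).trans (add_le_add ((norm_sub_le _ _).trans (add_le_add hq' hp'))
    (h3.trans (add_le_add hq hp)))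

/-- Second derivative test. -/
theorem norm_integral_quadExp_le_of_ne_zero {x t p q : ℝ} (hpq : p ≤ q) (ht : t ≠ 0) :
    ‖∫ v in p..q, quadExp x t v‖ ≤ 6 / √|t| := by
  have ht' : 0 < |t| := abs_pos.2 ht
  set s := √|t| with hs
  have hs0 : 0 < s := Real.sqrt_pos.2 ht'
  have hss : s * s = |t| := Real.mul_self_sqrt ht'.le
  -- The stationary point of the phase. The window of radius `1 / s` around it contributes at most
  -- its length `2 / s`; on each side the phase derivative is at least `2 * s`, which contributes `4
  -- / (2 * s)`.
  set c := -x / (2 * t) with hc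
  have habs : ∀ v, |x + 2 * t * v| = 2 * (s * s) * |v - c| := fun v => by
    rw [hss, ← abs_two (α := ℝ), ← abs_mul, ← abs_mul, hc]
    congr 1
    field_simp
    ring
  have far : ∀ v, 1 / s ≤ |v - c| → 2 * s ≤ |x + 2 * t * v| := fun v hv => by
    rw [habs]
    calc 2 * s = 2 * (s * s) * (1 / s) := by field_simp
      _ ≤ _ := by gcongr
  have e6 : 6 / s = 2 / s + (2 / s + 2 / s) := by ring
  have e4 : 4 / (2 * s) = 2 / s := by field_simp; norm_num
  have hpos : 0 ≤ 2 / s := by positivity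
  rw [e6]
  refine norm_integral_le_of_split (continuous_quadExp x t) (c := c - 1 / s) hpq hpos
    (by positivity) ?_ ?_
  · intro r hpr _ hrc
    rw [← e4]
    refine norm_integral_quadExp_le_of_le_deriv hpr (by positivity) fun v hv => far v ?_
    rw [abs_sub_comm]
    exact le_trans (by linarith [hv.2]) (le_abs_self _)
  intro r _ hrq hcr
  refine norm_integral_le_of_split (continuous_quadExp x t) (c := c + 1 / s) hrq hpos hpos ?_ ?_
  · intro r' hr _ hrc
    have := intervalIntegral.norm_integral_le_of_norm_le_const (a := r) (b := r') (C := 1)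
      (f := quadExp x t) (fun v _ => (norm_quadExp x t v).le)
    refine this.trans ?_
    rw [one_mul, abs_of_nonneg (by linarith)]
    calc r' - r ≤ 1 / s + 1 / s := by linarith
      _ = 2 / s := by ring
  · intro r' _ hr' hcr'
    rw [← e4]
    refine norm_integral_quadExp_le_of_le_deriv hr' (by positivity) fun v hv => far v ?_
    exact le_trans (by linarith [hv.1]) (le_abs_self _)

/-! ### Weighted oscillatory integrals -/

/-- The weight `(1 + |v|)^(-1/2)`. -/
noncomputable def weight (v : ℝ) : ℝ := (√(1 + |v|))⁻¹

theorem weight_pos (v : ℝ) : 0 < weight v := by unfold weight; positivity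

theorem weight_le_one (v : ℝ) : weight v ≤ 1 := by
  unfold weight
  apply inv_le_one_of_one_le₀
  rw [Real.one_le_sqrt]
  linarith [abs_nonneg v]

theorem continuous_weight : Continuous weight := by
  unfold weight
  exact Continuous.inv₀ (by fun_prop) fun v => by positivity

theorem weight_neg (v : ℝ) : weight (-v) = weight v := by simp [weight]

theorem weight_le {v : ℝ} (hv : 0 < v) : weight v ≤ 1 / √v := by
  rw [weight, ← one_div]
  apply one_div_le_one_div_of_le (by positivity)
  apply Real.sqrt_le_sqrt
  rw [abs_of_pos hv]; linarith

theorem norm_integral_mul_weight_le {F : ℝ → ℂ} (hF : Continuous F) {p q M : ℝ} (hp : 0 ≤ p)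
    (hpq : p ≤ q) (hM : ∀ r ∈ Set.Icc p q, ‖∫ v in p..r, F v‖ ≤ M) :
    ‖∫ v in p..q, F v * (weight v : ℂ)‖ ≤ M * weight p := by
  have hW : ∀ v, 0 ≤ v → weight v = (√(1 + v))⁻¹ := fun v hv => by
    rw [weight, abs_of_nonneg hv]
  -- Dropping the absolute value gives a function that is differentiable at `0` as well.
  have e : ∫ v in p..q, F v * (weight v : ℂ) = ∫ v in p..q, F v * (((√(1 + v))⁻¹ : ℝ) : ℂ) := by
    refine intervalIntegral.integral_congr fun v hv => ?_
    rw [Set.uIcc_of_le hpq] at hv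
    simp only [hW v (hp.trans hv.1)]
  rw [e, hW p hp]
  have hpos : ∀ v ∈ Set.Icc p q, 0 < 1 + v := fun v hv => by linarith [hv.1]
  refine norm_integral_mul_antitone_le hF (ρ := fun v => (√(1 + v))⁻¹)
    (ρ' := fun v => -(1 / (2 * √(1 + v))) / (√(1 + v)) ^ 2) hpq ?_ ?_ ?_ (by positivity) hM
  · intro v hv
    have h0 := hpos v hv
    have h1 : HasDerivAt (fun v : ℝ => 1 + v) 1 v := (hasDerivAt_id v).const_add 1
    exact (h1.sqrt h0.ne').inv (Real.sqrt_pos.2 h0).ne'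
  · intro v hv
    have h0 := Real.sqrt_pos.2 (hpos v hv)
    apply ContinuousAt.continuousWithinAt
    apply ContinuousAt.div
    · apply ContinuousAt.neg
      apply ContinuousAt.div (by fun_prop) (by fun_prop) (by positivity)
    · fun_prop
    · positivity
  · intro v hv
    apply div_nonpos_of_nonpos_of_nonneg _ (sq_nonneg _)
    have : 0 ≤ 1 / (2 * √(1 + v)) := by positivity
    linarith

theorem norm_integral_mul_weight_le_sqrt {F : ℝ → ℂ} (hF : ∀ v, ‖F v‖ = 1) {r : ℝ} (hr : 0 ≤ r) :
    ‖∫ v in (0 : ℝ)..r, F v * (weight v : ℂ)‖ ≤ 2 * √r := by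
  have h1 : ‖∫ v in (0 : ℝ)..r, F v * (weight v : ℂ)‖ ≤ ∫ v in (0 : ℝ)..r, weight v := by
    refine intervalIntegral.norm_integral_le_of_norm_le hr ?_
      (continuous_weight.intervalIntegrable _ _)
    refine Filter.Eventually.of_forall fun v _ => ?_
    rw [norm_mul, hF, one_mul, Complex.norm_real, Real.norm_of_nonneg (weight_pos v).le]
  have h2 : ∫ v in (0 : ℝ)..r, weight v = 2 * √(1 + r) - 2 * √(1 + 0) := by
    refine intervalIntegral.integral_eq_sub_of_hasDerivAt (f := fun v => 2 * √(1 + v)) ?_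
      (continuous_weight.intervalIntegrable _ _)
    intro v hv
    rw [Set.uIcc_of_le hr] at hv
    have h0 : 0 < 1 + v := by linarith [hv.1]
    have := (((hasDerivAt_id v).const_add 1).sqrt h0.ne').const_mul 2
    refine this.congr_deriv ?_
    rw [weight, abs_of_nonneg hv.1]
    simp only [id]
    field_simp
  refine h1.trans ?_
  rw [h2]
  have : √(1 + r) ≤ 1 + √r := by
    rw [Real.sqrt_le_left (by positivity)]
    nlinarith [Real.sq_sqrt hr, Real.sqrt_nonneg r]
  rw [add_zero, Real.sqrt_one]
  linarith

theorem continuous_quadExp_mul_weight (x t : ℝ) :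
    Continuous fun v => quadExp x t v * (weight v : ℂ) :=
  (continuous_quadExp x t).mul (Complex.continuous_ofReal.comp continuous_weight)

theorem norm_integral_quadExp_mul_weight_le_of_ne_zero {x t p q : ℝ} (ht : t ≠ 0) (hp : 0 < p)
    (hpq : p ≤ q) :
    ‖∫ v in p..q, quadExp x t v * (weight v : ℂ)‖ ≤ 6 / √|t| * (1 / √p) := by
  refine (norm_integral_mul_weight_le (continuous_quadExp x t) hp.le hpq fun r hr =>
    norm_integral_quadExp_le_of_ne_zero hr.1 ht).trans ?_
  gcongr
  exact weight_le hp

/-- Three ranges of `v`. Up to `1 / |x|` the trivial bound suffices. From there to `|x| / (4|t|)`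
the phase derivative is at least `|x| / 2` and the weight at most `√|x|`. Beyond, the second
derivative test applies with weight at most `v^(-1/2) ≤ 2√(|t| / |x|)`. The bound does not depend on
`t` or `N`. -/
theorem norm_integral_quadExp_mul_weight_le_left {x t N : ℝ} (hx : x ≠ 0) (hN : 0 ≤ N) :
    ‖∫ v in (0 : ℝ)..N, quadExp x t v * (weight v : ℂ)‖ ≤ 22 / √|x| := by
  have hx' : 0 < |x| := abs_pos.2 hx
  have hs : 0 < √|x| := Real.sqrt_pos.2 hx'
  have hss : √|x| * √|x| = |x| := Real.mul_self_sqrt hx'.le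
  have hcont := continuous_quadExp_mul_weight x t
  have e : 22 / √|x| = 2 / √|x| + (8 / √|x| + 12 / √|x|) := by ring
  rw [e]
  refine norm_integral_le_of_split hcont (c := 1 / |x|) hN (by positivity) (by positivity) ?_ ?_
  · intro r hr _ hrc
    refine (norm_integral_mul_weight_le_sqrt (norm_quadExp x t) hr).trans ?_
    calc 2 * √r ≤ 2 * √(1 / |x|) := by gcongr
      _ = 2 / √|x| := by rw [Real.sqrt_div zero_le_one, Real.sqrt_one]; ring
  intro r _ hrN hcr
  have hr0 : 0 < r := lt_of_lt_of_le (by positivity) hcr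
  have hwr' : 1 / √r ≤ √|x| := by
    rw [div_le_iff₀ (Real.sqrt_pos.2 hr0), ← Real.sqrt_mul hx'.le, Real.one_le_sqrt]
    rw [div_le_iff₀ hx'] at hcr
    linarith
  have hwr : weight r ≤ √|x| := (weight_le hr0).trans hwr'
  refine norm_integral_le_of_split hcont (c := |x| / (4 * |t|)) hrN (by positivity)
    (by positivity) ?_ ?_
  · intro q hrq _ hqc
    have hfirst : ∀ r' ∈ Set.Icc r q, ‖∫ v in r..r', quadExp x t v‖ ≤ 4 / (|x| / 2) := by
      intro r' hr'
      refine norm_integral_quadExp_le_of_le_deriv hr'.1 (by positivity) fun v hv => ?_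
      have hv0 : 0 < v := hr0.trans_le hv.1
      have hvc : v ≤ |x| / (4 * |t|) := hv.2.trans (hr'.2.trans hqc)
      have ht0 : 0 < |t| := by
        rcases eq_or_ne t 0 with rfl | h
        · simp at hvc; linarith
        · exact abs_pos.2 h
      rw [le_div_iff₀ (by positivity)] at hvc
      have h2 : |2 * t * v| = 2 * |t| * v := by
        rw [abs_mul, abs_mul, abs_two, abs_of_pos hv0]
      have h3 := abs_sub_abs_le_abs_add x (2 * t * v)
      linarith
    refine (norm_integral_mul_weight_le (continuous_quadExp x t) hr0.le hrq hfirst).trans ?_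
    calc 4 / (|x| / 2) * weight r ≤ 4 / (|x| / 2) * √|x| := by gcongr
      _ = 8 / √|x| := by
        nth_rewrite 1 [← hss]
        field_simp
        norm_num
  · intro p hrp hpN hcp
    -- For `t = 0` the second cutting point is `|x| / 0 = 0`, so the middle range is empty and
    -- everything beyond `1 / |x|` falls here, with constant phase derivative `x`.
    rcases eq_or_ne t 0 with rfl | ht
    · have hfirst : ∀ r' ∈ Set.Icc p N, ‖∫ v in p..r', quadExp x 0 v‖ ≤ 4 / |x| := by
        intro r' hr'
        refine norm_integral_quadExp_le_of_le_deriv hr'.1 hx' fun v hv => ?_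
        simp
      refine (norm_integral_mul_weight_le (continuous_quadExp x 0) (hr0.le.trans hrp) hpN
        hfirst).trans ?_
      have hwp : weight p ≤ √|x| := by
        refine (weight_le (hr0.trans_le hrp)).trans (le_trans ?_ hwr')
        exact one_div_le_one_div_of_le (Real.sqrt_pos.2 hr0) (Real.sqrt_le_sqrt hrp)
      calc 4 / |x| * weight p ≤ 4 / |x| * √|x| := by gcongr
        _ = 4 / √|x| := by
          nth_rewrite 1 [← hss]
          field_simp
        _ ≤ 12 / √|x| := by gcongr; norm_num
    · have ht' : 0 < |t| := abs_pos.2 ht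
      have hp0 : 0 < p := hr0.trans_le hrp
      refine (norm_integral_quadExp_mul_weight_le_of_ne_zero ht hp0 hpN).trans ?_
      have hle : √|x| ≤ 2 * (√|t| * √p) := by
        rw [← Real.sqrt_mul ht'.le, Real.sqrt_le_left (by positivity), mul_pow,
          Real.sq_sqrt (by positivity)]
        rw [div_le_iff₀ (by positivity)] at hcp
        linarith
      rw [div_mul_div_comm, mul_one, div_le_div_iff₀ (by positivity) hs]
      linarith

/-- Cut at `1 / √|t|`: below, the trivial bound; above, the second derivative test with weight at
most `|t|^(1/4)`. -/
theorem norm_integral_quadExp_mul_weight_le_right {x t N : ℝ} (ht : t ≠ 0) (hN : 0 ≤ N) :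
    ‖∫ v in (0 : ℝ)..N, quadExp x t v * (weight v : ℂ)‖ ≤ 8 / √√|t| := by
  have ht' : 0 < |t| := abs_pos.2 ht
  have hs : 0 < √|t| := Real.sqrt_pos.2 ht'
  have hss : 0 < √√|t| := Real.sqrt_pos.2 hs
  have hmul : √√|t| * √√|t| = √|t| := Real.mul_self_sqrt hs.le
  have e : 8 / √√|t| = 2 / √√|t| + 6 / √√|t| := by ring
  rw [e]
  refine norm_integral_le_of_split (continuous_quadExp_mul_weight x t) (c := 1 / √|t|) hN
    (by positivity) (by positivity) ?_ ?_
  · intro r hr _ hrc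
    refine (norm_integral_mul_weight_le_sqrt (norm_quadExp x t) hr).trans ?_
    calc 2 * √r ≤ 2 * √(1 / √|t|) := by gcongr
      _ = 2 / √√|t| := by rw [Real.sqrt_div zero_le_one, Real.sqrt_one]; ring
  · intro p _ hpN hcp
    have hp0 : 0 < p := lt_of_lt_of_le (by positivity) hcp
    refine (norm_integral_quadExp_mul_weight_le_of_ne_zero ht hp0 hpN).trans ?_
    have hle : 1 ≤ √√|t| * √p := by
      rw [← Real.sqrt_mul hs.le, Real.one_le_sqrt]
      rw [div_le_iff₀ hs] at hcp
      linarith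
    rw [div_mul_div_comm, mul_one, div_le_div_iff₀ (by positivity) hss]
    have h := mul_le_mul_of_nonneg_left hle hss.le
    rw [← mul_assoc, hmul] at h
    linarith

/-- The reflection `v ↦ -v` fixes the weight and `t` and changes the sign of `x`, which reduces
symmetric integrals to half-lines. -/
theorem norm_integral_symm_quadExp_mul_weight_le {x t N B : ℝ}
    (h₁ : ‖∫ v in (0 : ℝ)..N, quadExp x t v * (weight v : ℂ)‖ ≤ B)
    (h₂ : ‖∫ v in (0 : ℝ)..N, quadExp (-x) t v * (weight v : ℂ)‖ ≤ B) :
    ‖∫ v in (-N)..N, quadExp x t v * (weight v : ℂ)‖ ≤ 2 * B := by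
  have hcont := continuous_quadExp_mul_weight x t
  rw [← intervalIntegral.integral_add_adjacent_intervals (hcont.intervalIntegrable (-N) 0)
    (hcont.intervalIntegrable 0 N)]
  have e : ∫ v in (-N)..0, quadExp x t v * (weight v : ℂ) =
      ∫ v in (0 : ℝ)..N, quadExp (-x) t v * (weight v : ℂ) := by
    have := intervalIntegral.integral_comp_neg (a := 0) (b := N)
      (fun v => quadExp x t v * (weight v : ℂ))
    rw [neg_zero] at this
    rw [← this]
    simp only [quadExp_neg, weight_neg]
  rw [e]
  refine (norm_add_le _ _).trans ?_
  linarith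

theorem norm_integral_symm_le_left {x t N : ℝ} (hx : x ≠ 0) (hN : 0 ≤ N) :
    ‖∫ v in (-N)..N, quadExp x t v * (weight v : ℂ)‖ ≤ 2 * (22 / √|x|) :=
  norm_integral_symm_quadExp_mul_weight_le (norm_integral_quadExp_mul_weight_le_left hx hN)
    (by simpa using norm_integral_quadExp_mul_weight_le_left (t := t) (neg_ne_zero.2 hx) hN)

theorem norm_integral_symm_le_right {x t N : ℝ} (ht : t ≠ 0) (hN : 0 ≤ N) :
    ‖∫ v in (-N)..N, quadExp x t v * (weight v : ℂ)‖ ≤ 2 * (8 / √√|t|) :=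
  norm_integral_symm_quadExp_mul_weight_le (norm_integral_quadExp_mul_weight_le_right ht hN)
    (norm_integral_quadExp_mul_weight_le_right ht hN)

/-! ### Duality, Schur's test and the `TT*` argument -/

theorem norm_integral_kernel_le {X Y : Type*} [MeasurableSpace Y] {ν : Measure Y} {e : X → Y → ℂ}
    (he1 : ∀ x y, ‖e x y‖ ≤ 1) {g : Y → ℂ} (hg : Integrable g ν)
    (x : X) : ‖∫ y, e x y * g y ∂ν‖ ≤ ∫ y, ‖g y‖ ∂ν := by
  refine norm_integral_le_of_norm_le hg.norm (Filter.Eventually.of_forall fun y => ?_)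
  rw [norm_mul]
  exact mul_le_of_le_one_left (norm_nonneg _) (he1 x y)

section DualityArgument

variable {X Y : Type*} [MeasurableSpace X] [MeasurableSpace Y] {μ : Measure X} {ν : Measure Y}
  {e : X → Y → ℂ}

theorem integrable_kernel_mul_mul (he : Measurable (Function.uncurry e)) (he1 : ∀ x y, ‖e x y‖ ≤ 1)
    {g : Y → ℂ} {S : X → ℂ} (hg : Integrable g ν) (hS : Integrable S μ) :
    Integrable (fun p : X × Y => e p.1 p.2 * (S p.1 * g p.2)) (μ.prod ν) := by
  refine (hS.mul_prod hg).bdd_mul (c := 1) he.aestronglyMeasurable ?_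
  exact Filter.Eventually.of_forall fun p => he1 p.1 p.2

theorem integrable_integral_kernel [IsFiniteMeasure μ] [IsFiniteMeasure ν]
    (he : Measurable (Function.uncurry e))
    (he1 : ∀ x y, ‖e x y‖ ≤ 1) {g : Y → ℂ} (hg : Integrable g ν) :
    Integrable (fun x => ∫ y, e x y * g y ∂ν) μ := by
  have h := integrable_kernel_mul_mul (μ := μ) he he1 hg (integrable_const (1 : ℂ))
  simpa using h.integral_prod_left

/-- Duality between integration of a bounded kernel in its two variables. -/
theorem integral_mul_integral_kernel [IsFiniteMeasure μ] [IsFiniteMeasure ν]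
    (he : Measurable (Function.uncurry e)) (he1 : ∀ x y, ‖e x y‖ ≤ 1) {g : Y → ℂ} {S : X → ℂ}
    (hg : Integrable g ν) (hS : Integrable S μ) :
    ∫ y, g y * (∫ x, e x y * S x ∂μ) ∂ν = ∫ x, (∫ y, e x y * g y ∂ν) * S x ∂μ := by
  have h1 : ∀ y, g y * (∫ x, e x y * S x ∂μ) = ∫ x, e x y * (S x * g y) ∂μ := fun y => by
    rw [← MeasureTheory.integral_const_mul (g y)]
    exact integral_congr_ae (Filter.Eventually.of_forall fun x => by ring)
  have h2 : ∀ x, (∫ y, e x y * g y ∂ν) * S x = ∫ y, e x y * (S x * g y) ∂ν := fun x => by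
    rw [← MeasureTheory.integral_mul_const (S x)]
    exact integral_congr_ae (Filter.Eventually.of_forall fun y => by ring)
  simp_rw [h1, h2]
  exact (integral_integral_swap (integrable_kernel_mul_mul he he1 hg hS)).symm

theorem integrable_conj {g : Y → ℂ} (hg : Integrable g ν) :
    Integrable (fun y => (starRingEnd ℂ) (g y)) ν :=
  ⟨Complex.continuous_conj.comp_aestronglyMeasurable hg.1, by
    simpa [HasFiniteIntegral] using hg.2⟩

theorem integral_mul_conj_integral_kernel [IsFiniteMeasure μ] [IsFiniteMeasure ν]
    (he : Measurable (Function.uncurry e)) (he1 : ∀ x y, ‖e x y‖ ≤ 1) {g : Y → ℂ} {S : X → ℂ}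
    (hg : Integrable g ν) (hS : Integrable S μ) :
    ∫ y, g y * (∫ x, e x y * (starRingEnd ℂ) (S x) ∂μ) ∂ν =
      ∫ x, (∫ y, e x y * g y ∂ν) * (starRingEnd ℂ) (S x) ∂μ :=
  integral_mul_integral_kernel he he1 hg (integrable_conj hS)

/-- Schur's test for a bounded kernel with symmetric modulus. -/
theorem norm_integral_integral_mul_conj_le [IsFiniteMeasure μ] {K : X → X → ℂ} {C B : ℝ}
    (hK : AEStronglyMeasurable (Function.uncurry K) (μ.prod μ)) (hKB : ∀ x x', ‖K x x'‖ ≤ B)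
    (hsymm : ∀ x x', ‖K x x'‖ = ‖K x' x‖) (hC : ∀ᵐ x ∂μ, ∫ x', ‖K x x'‖ ∂μ ≤ C)
    {S : X → ℂ} (hS : AEStronglyMeasurable S μ) {D : ℝ} (hSD : ∀ x, ‖S x‖ ≤ D) :
    ‖∫ x, (∫ x', K x x' * S x' ∂μ) * (starRingEnd ℂ) (S x) ∂μ‖ ≤ C * ∫ x, ‖S x‖ ^ 2 ∂μ := by
  have hS2 : Integrable (fun x => ‖S x‖ ^ 2) μ := by
    refine Integrable.of_bound (hS.norm.pow 2) (D ^ 2) (Filter.Eventually.of_forall fun x => ?_)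
    rw [Real.norm_of_nonneg (by positivity)]
    have := hSD x
    gcongr
  have hKn : Integrable (fun p : X × X => ‖K p.1 p.2‖) (μ.prod μ) :=
    (Integrable.of_bound hK B (Filter.Eventually.of_forall fun p => hKB p.1 p.2)).norm
  have hi1 : Integrable (fun p : X × X => ‖K p.1 p.2‖ * ‖S p.1‖ ^ 2) (μ.prod μ) := by
    refine (hS2.comp_fst μ).bdd_mul (c := B) hKn.1
      (Filter.Eventually.of_forall fun p => ?_)
    rw [norm_norm]; exact hKB p.1 p.2
  have hi2 : Integrable (fun p : X × X => ‖K p.1 p.2‖ * ‖S p.2‖ ^ 2) (μ.prod μ) := by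
    refine (hS2.comp_snd μ).bdd_mul (c := B) hKn.1
      (Filter.Eventually.of_forall fun p => ?_)
    rw [norm_norm]; exact hKB p.1 p.2
  have h1 : ∫ p, ‖K p.1 p.2‖ * ‖S p.1‖ ^ 2 ∂(μ.prod μ) ≤ C * ∫ x, ‖S x‖ ^ 2 ∂μ := by
    rw [integral_prod _ hi1, ← integral_const_mul]
    refine integral_mono_ae hi1.integral_prod_left (hS2.const_mul C) ?_
    filter_upwards [hC] with x hx
    rw [integral_mul_const]
    gcongr
  have h2 : ∫ p, ‖K p.1 p.2‖ * ‖S p.2‖ ^ 2 ∂(μ.prod μ) =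
      ∫ p, ‖K p.1 p.2‖ * ‖S p.1‖ ^ 2 ∂(μ.prod μ) := by
    rw [← integral_prod_swap]
    refine integral_congr_ae (Filter.Eventually.of_forall fun p => ?_)
    simp only [Prod.fst_swap, Prod.snd_swap]
    rw [hsymm]
  have hbound : ∀ x, ‖(∫ x', K x x' * S x' ∂μ) * (starRingEnd ℂ) (S x)‖ ≤
      ∫ x', ‖K x x'‖ * ‖S x'‖ * ‖S x‖ ∂μ := fun x => by
    rw [norm_mul, RCLike.norm_conj, integral_mul_const]
    gcongr
    refine (norm_integral_le_integral_norm _).trans_eq ?_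
    simp only [norm_mul]
  have hi3 : Integrable (fun p : X × X => ‖K p.1 p.2‖ * ‖S p.2‖ * ‖S p.1‖) (μ.prod μ) := by
    refine (hi1.add hi2).mono' ?_ (Filter.Eventually.of_forall fun p => ?_)
    · exact (hKn.1.mul hS.norm.comp_snd).mul hS.norm.comp_fst
    · rw [Real.norm_of_nonneg (by positivity), Pi.add_apply]
      nlinarith [mul_nonneg (norm_nonneg (K p.1 p.2)) (sq_nonneg (‖S p.1‖ - ‖S p.2‖)),
        mul_nonneg (norm_nonneg (K p.1 p.2)) (sq_nonneg (‖S p.1‖)),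
        mul_nonneg (norm_nonneg (K p.1 p.2)) (sq_nonneg (‖S p.2‖))]
  calc _ ≤ ∫ x, ∫ x', ‖K x x'‖ * ‖S x'‖ * ‖S x‖ ∂μ ∂μ :=
        norm_integral_le_of_norm_le hi3.integral_prod_left (Filter.Eventually.of_forall hbound)
    _ = ∫ p, ‖K p.1 p.2‖ * ‖S p.2‖ * ‖S p.1‖ ∂(μ.prod μ) := (integral_prod _ hi3).symm
    -- Bound `‖S x'‖ ‖S x‖` by half the sum of the squares; since the modulus of `K` is symmetric,
    -- both squares contribute equally and the row bound alone suffices.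
    _ ≤ ∫ p, (1 / 2) * (‖K p.1 p.2‖ * ‖S p.1‖ ^ 2 + ‖K p.1 p.2‖ * ‖S p.2‖ ^ 2) ∂(μ.prod μ) := by
        refine integral_mono hi3 ((hi1.add hi2).const_mul _) fun p => ?_
        simp only
        nlinarith [mul_nonneg (norm_nonneg (K p.1 p.2)) (sq_nonneg (‖S p.1‖ - ‖S p.2‖))]
    _ ≤ _ := by
        rw [integral_const_mul, integral_add hi1 hi2, h2]
        linarith

/-- The `TT*` argument: a bound for the kernel of `TT*` in Schur's test gives a weighted `L²` bound
for `T`. -/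
theorem integral_norm_sq_integral_kernel_le [IsFiniteMeasure μ] [IsFiniteMeasure ν]
    (he : Measurable (Function.uncurry e))
    (he1 : ∀ x y, ‖e x y‖ ≤ 1) {ρ : Y → ℝ} (hρ : Measurable ρ) (hρ0 : ∀ y, 0 < ρ y)
    (hρ1 : ∀ y, ρ y ≤ 1) {C : ℝ} (hC0 : 0 < C)
    (hC : ∀ᵐ x ∂μ, ∫ x', ‖∫ y, e x y * (starRingEnd ℂ) (e x' y) * (ρ y : ℂ) ∂ν‖ ∂μ ≤ C)
    {g : Y → ℂ} (hg : Integrable g ν) (hgρ : Integrable (fun y => ‖g y‖ ^ 2 * (ρ y)⁻¹) ν) :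
    ∫ x, ‖∫ y, e x y * g y ∂ν‖ ^ 2 ∂μ ≤ C * ∫ y, ‖g y‖ ^ 2 * (ρ y)⁻¹ ∂ν := by
  set S : X → ℂ := fun x => ∫ y, e x y * g y ∂ν with hSdef
  have hS : Integrable S μ := integrable_integral_kernel he he1 hg
  have hSD : ∀ x, ‖S x‖ ≤ ∫ y, ‖g y‖ ∂ν := norm_integral_kernel_le he1 hg
  set A := ∫ x, ‖S x‖ ^ 2 ∂μ with hA
  -- `R` is the conjugate of `T* S`
  set R : Y → ℂ := fun y => ∫ x, e x y * (starRingEnd ℂ) (S x) ∂μ with hR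
  have hS' : Integrable (fun x => (starRingEnd ℂ) (S x)) μ := integrable_conj hS
  have he' : Measurable (Function.uncurry fun y x => e x y) := he.comp measurable_swap
  have hRi : Integrable R ν :=
    integrable_integral_kernel (e := fun y x => e x y) he' (fun y x => he1 x y) hS'
  have hRD : ∀ y, ‖R y‖ ≤ ∫ x, ‖(starRingEnd ℂ) (S x)‖ ∂μ :=
    norm_integral_kernel_le (e := fun y x => e x y) (fun y x => he1 x y) hS'
  have hρb : ∀ y, ‖(ρ y : ℂ)‖ ≤ 1 := fun y => by
    rw [Complex.norm_real, Real.norm_of_nonneg (hρ0 y).le]; exact hρ1 y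
  have hρm : AEStronglyMeasurable (fun y => (ρ y : ℂ)) ν :=
    (Complex.measurable_ofReal.comp hρ).aestronglyMeasurable
  have h1 : ∫ y, g y * R y ∂ν = (A : ℂ) := by
    rw [hR, integral_mul_conj_integral_kernel he he1 hg hS, hA, ← integral_complex_ofReal]
    congr 1 with x
    rw [Complex.mul_conj, Complex.normSq_eq_norm_sq]
  have hR2 : Integrable (fun y => ‖R y‖ ^ 2 * ρ y) ν := by
    refine Integrable.of_bound ((hRi.1.norm.pow 2).mul hρ.aestronglyMeasurable)
      ((∫ x, ‖(starRingEnd ℂ) (S x)‖ ∂μ) ^ 2 * 1) (Filter.Eventually.of_forall fun y => ?_)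
    rw [Real.norm_of_nonneg (mul_nonneg (by positivity) (hρ0 y).le)]
    exact mul_le_mul (pow_le_pow_left₀ (norm_nonneg _) (hRD y) 2) (hρ1 y) (hρ0 y).le (by positivity)
  -- With `T` the operator of kernel `e`, the left side is the pairing of `T ρ T* S` with `S`, to
  -- which Schur's test applies.
  have h2 : ∫ y, ‖R y‖ ^ 2 * ρ y ∂ν ≤ C * A := by
    have hgi : Integrable (fun y => (starRingEnd ℂ) (R y) * (ρ y : ℂ)) ν := by
      exact (integrable_conj hRi).mul_bdd (c := 1) hρm (Filter.Eventually.of_forall hρb)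
    have h3 : ∫ y, ((starRingEnd ℂ) (R y) * (ρ y : ℂ)) * R y ∂ν =
        ((∫ y, ‖R y‖ ^ 2 * ρ y ∂ν : ℝ) : ℂ) := by
      rw [← integral_complex_ofReal]
      congr 1 with y
      rw [mul_right_comm, mul_comm ((starRingEnd ℂ) (R y)), Complex.mul_conj,
        Complex.normSq_eq_norm_sq]
      push_cast
      rfl
    have h4 : ∀ x, ∫ y, e x y * ((starRingEnd ℂ) (R y) * (ρ y : ℂ)) ∂ν =
        ∫ x', (∫ y, e x y * (starRingEnd ℂ) (e x' y) * (ρ y : ℂ) ∂ν) * S x' ∂μ := fun x => by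
      have hgx : Integrable (fun y => (starRingEnd ℂ) (e x y) * (ρ y : ℂ)) ν := by
        refine Integrable.of_bound (AEStronglyMeasurable.mul ?_ hρm) (1 * 1)
          (Filter.Eventually.of_forall fun y => ?_)
        · exact Complex.continuous_conj.comp_aestronglyMeasurable
            (he.comp measurable_prodMk_left).aestronglyMeasurable
        · rw [norm_mul, RCLike.norm_conj]
          exact mul_le_mul (he1 x y) (hρb y) (norm_nonneg _) zero_le_one
      have h5 := congrArg (starRingEnd ℂ) (integral_mul_conj_integral_kernel he he1 hgx hS)
      rw [← integral_conj, ← integral_conj] at h5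
      calc _ = _ := ?_
        _ = _ := h5
        _ = _ := ?_
      · congr 1 with y
        simp only [map_mul, Complex.conj_conj, Complex.conj_ofReal]
        ring
      · congr 1 with x'
        rw [map_mul, Complex.conj_conj, ← integral_conj]
        congr 2 with y
        simp only [map_mul, Complex.conj_conj, Complex.conj_ofReal]
        ring
    have h6 := integral_mul_conj_integral_kernel he he1 hgi hS
    have h6' := congrArg norm (h3.symm.trans h6)
    simp only [h4] at h6'
    rw [Complex.norm_real, Real.norm_of_nonneg (integral_nonneg fun y =>
      mul_nonneg (by positivity) (hρ0 y).le)] at h6'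
    rw [h6']
    refine norm_integral_integral_mul_conj_le (B := ∫ _y, (1 : ℝ) ∂ν)
      (K := fun x x' => ∫ y, e x y * (starRingEnd ℂ) (e x' y) * (ρ y : ℂ) ∂ν) ?_ ?_ ?_ hC hS.1 hSD
    · have hm : Measurable fun q : (X × X) × Y =>
          e q.1.1 q.2 * (starRingEnd ℂ) (e q.1.2 q.2) * (ρ q.2 : ℂ) := by
        refine (Measurable.mul ?_ ?_).mul ?_
        · exact he.comp (f := fun q : (X × X) × Y => (q.1.1, q.2)) (by fun_prop)
        · exact Complex.continuous_conj.measurable.comp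
            (he.comp (f := fun q : (X × X) × Y => (q.1.2, q.2)) (by fun_prop))
        · exact Complex.measurable_ofReal.comp (hρ.comp measurable_snd)
      exact (hm.stronglyMeasurable.integral_prod_right' (ν := ν)).aestronglyMeasurable
    · intro x x'
      refine norm_integral_le_of_norm_le (integrable_const 1)
        (Filter.Eventually.of_forall fun y => ?_)
      rw [norm_mul, norm_mul, RCLike.norm_conj]
      exact mul_le_one₀ (mul_le_one₀ (he1 x y) (norm_nonneg _) (he1 x' y)) (norm_nonneg _) (hρb y)
    · intro x x'
      rw [← RCLike.norm_conj, ← integral_conj]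
      congr 2 with y
      simp only [map_mul, Complex.conj_conj, Complex.conj_ofReal]
      ring
  -- complete the square
  have hgR : Integrable (fun y => g y * R y) ν :=
    hg.mul_bdd (c := ∫ x, ‖(starRingEnd ℂ) (S x)‖ ∂μ) hRi.1 (Filter.Eventually.of_forall hRD)
  have h7 : A ≤ ∫ y, ((C / 2) * (‖g y‖ ^ 2 * (ρ y)⁻¹) + (1 / (2 * C)) * (‖R y‖ ^ 2 * ρ y)) ∂ν := by
    calc A = ‖∫ y, g y * R y ∂ν‖ := by
          rw [h1, Complex.norm_real, Real.norm_of_nonneg (integral_nonneg fun x => by positivity)]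
      _ ≤ _ := by
          refine norm_integral_le_of_norm_le ((hgρ.const_mul _).add (hR2.const_mul _))
            (Filter.Eventually.of_forall fun y => ?_)
          have hp := hρ0 y
          rw [norm_mul]
          have hsq : (C / 2) * (‖g y‖ ^ 2 * (ρ y)⁻¹) + (1 / (2 * C)) * (‖R y‖ ^ 2 * ρ y) -
              ‖g y‖ * ‖R y‖ = (C / (2 * ρ y)) * (‖g y‖ - ρ y / C * ‖R y‖) ^ 2 := by
            field_simp
            ring
          have : 0 ≤ (C / (2 * ρ y)) * (‖g y‖ - ρ y / C * ‖R y‖) ^ 2 := by positivity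
          linarith
  rw [integral_add (hgρ.const_mul _) (hR2.const_mul _), integral_const_mul,
    integral_const_mul] at h7
  -- The square was completed with the factor that makes the `R`-term at most `A / 2`, so it is
  -- absorbed on the left.
  have h8 : (1 / (2 * C)) * ∫ y, ‖R y‖ ^ 2 * ρ y ∂ν ≤ A / 2 := by
    calc _ ≤ (1 / (2 * C)) * (C * A) := by gcongr
      _ = A / 2 := by field_simp
  linarith

end DualityArgument

/-! ### The truncated kernel and the linearised maximal estimate -/

theorem setIntegral_indicator_Ioc_symm {m N : ℝ} (hm : 0 ≤ m) (hmN : m ≤ N) (F : ℝ → ℂ) :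
    ∫ v in Set.Ioc (-N) N, (Set.Ioc (-m) m).indicator F v = ∫ v in (-m)..m, F v := by
  rw [setIntegral_indicator measurableSet_Ioc, intervalIntegral.integral_of_le (by linarith),
    Set.inter_eq_self_of_subset_right (Set.Ioc_subset_Ioc (by linarith) hmN)]

/-- The oscillating kernel `e^(i(β(u)uv + α(u)v²))` truncated to `|v| ≤ ν(u)`. -/
noncomputable def truncatedKernel (α β ν : ℝ → ℝ) (u v : ℝ) : ℂ :=
  (Set.Ioc (-ν u) (ν u)).indicator (quadExp (β u * u) (α u)) v

theorem measurable_truncatedKernel {α β ν : ℝ → ℝ} (hα : Measurable α) (hβ : Measurable β)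
    (hν : Measurable ν) : Measurable (Function.uncurry (truncatedKernel α β ν)) := by
  have e : Function.uncurry (truncatedKernel α β ν) =
      Set.indicator {p : ℝ × ℝ | -ν p.1 < p.2 ∧ p.2 ≤ ν p.1}
        (fun p => quadExp (β p.1 * p.1) (α p.1) p.2) := by
    ext ⟨u, v⟩
    simp [truncatedKernel, Set.indicator, Function.uncurry]
  rw [e]
  refine Measurable.indicator ?_ ?_
  · unfold quadExp; fun_prop
  · exact (measurableSet_lt (hν.comp measurable_fst).neg measurable_snd).inter
      (measurableSet_le measurable_snd (hν.comp measurable_fst))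

theorem norm_truncatedKernel_le (α β ν : ℝ → ℝ) (u v : ℝ) : ‖truncatedKernel α β ν u v‖ ≤ 1 := by
  refine (norm_indicator_le_norm_self _ _).trans ?_
  rw [norm_quadExp]

theorem integral_truncatedKernel_mul {α β ν : ℝ → ℝ} {N u : ℝ} (h0 : 0 ≤ ν u) (hN : ν u ≤ N)
    (g : ℝ → ℂ) :
    ∫ v in Set.Ioc (-N) N, truncatedKernel α β ν u v * g v =
      ∫ v in (-ν u)..(ν u), quadExp (β u * u) (α u) v * g v := by
  rw [← setIntegral_indicator_Ioc_symm h0 hN]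
  simp only [truncatedKernel, Set.indicator_mul_left]

/-- Two symmetric truncations intersect in the smaller one, and conjugation subtracts the phases.
The kernel of `TT*` is thus again a symmetric oscillatory integral. -/
theorem integral_truncatedKernel_mul_conj {α β ν : ℝ → ℝ} {N u u' : ℝ} (h0 : 0 ≤ ν u)
    (hN : ν u ≤ N) (h0' : 0 ≤ ν u') :
    ∫ v in Set.Ioc (-N) N, truncatedKernel α β ν u v *
        (starRingEnd ℂ) (truncatedKernel α β ν u' v) * (weight v : ℂ) =
      ∫ v in (-min (ν u) (ν u'))..(min (ν u) (ν u')),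
        quadExp (β u * u - β u' * u') (α u - α u') v * (weight v : ℂ) := by
  rw [← setIntegral_indicator_Ioc_symm (le_min h0 h0') ((min_le_left _ _).trans hN)]
  congr 1 with v
  have e : quadExp (β u * u - β u' * u') (α u - α u') v =
      quadExp (β u * u) (α u) v * (starRingEnd ℂ) (quadExp (β u' * u') (α u') v) := by
    rw [conj_quadExp, quadExp_mul]
    rfl
  have hI : Set.Ioc (-min (ν u) (ν u')) (min (ν u) (ν u')) =
      Set.Ioc (-ν u) (ν u) ∩ Set.Ioc (-ν u') (ν u') := by
    rw [Set.Ioc_inter_Ioc, ← max_neg_neg]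
  rw [hI]
  by_cases h : v ∈ Set.Ioc (-ν u) (ν u)
  · by_cases h' : v ∈ Set.Ioc (-ν u') (ν u')
    · simp only [truncatedKernel, Set.indicator_of_mem h, Set.indicator_of_mem h',
        Set.indicator_of_mem (Set.mem_inter h h'), e]
    · have : v ∉ Set.Ioc (-ν u) (ν u) ∩ Set.Ioc (-ν u') (ν u') := fun hh => h' hh.2
      simp [truncatedKernel, Set.indicator_of_notMem h', Set.indicator_of_notMem this]
  · have : v ∉ Set.Ioc (-ν u) (ν u) ∩ Set.Ioc (-ν u') (ν u') := fun hh => h hh.1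
    simp [truncatedKernel, Set.indicator_of_notMem h, Set.indicator_of_notMem this]

/-- If the phase shift `βu - β'u'` is small compared with `u - u'`, then `α - α'` is not. -/
theorem norm_integral_quadExp_sub_mul_weight_le {R c K : ℝ} (hR : 0 < R) (hc : 0 < c) (hK : 0 < K)
    {α α' β β' u u' N : ℝ} (hN : 0 ≤ N) (hu : |u| ≤ R) (hu' : |u'| ≤ R) (huu : u ≠ u')
    (hβ : c ≤ |β|) (hαβ : |β - β'| ≤ K * |α - α'|) :
    ‖∫ v in (-N)..N, quadExp (β * u - β' * u') (α - α') v * (weight v : ℂ)‖ ≤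
      (44 / √(c / 2) + 16 * √√(2 * R) / √√(c / (2 * K * R))) * (1 / √|u - u'|) := by
  have hd : 0 < |u - u'| := abs_pos.2 (sub_ne_zero.2 huu)
  have hd2 : |u - u'| ≤ 2 * R := (abs_sub _ _).trans (by linarith)
  rcases le_or_gt (c * |u - u'| / 2) |β * u - β' * u'| with h | h
  · have hx : β * u - β' * u' ≠ 0 := by
      rw [← abs_pos]
      exact lt_of_lt_of_le (by positivity) h
    refine (norm_integral_symm_le_left hx hN).trans ?_
    have h1 : √(c / 2) * √|u - u'| ≤ √|β * u - β' * u'| := by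
      rw [← Real.sqrt_mul (by positivity)]
      apply Real.sqrt_le_sqrt
      linarith
    calc 2 * (22 / √|β * u - β' * u'|) = 44 / √|β * u - β' * u'| := by ring
      _ ≤ 44 / (√(c / 2) * √|u - u'|) := by gcongr
      _ = 44 / √(c / 2) * (1 / √|u - u'|) := by field_simp
      _ ≤ _ := by
        apply mul_le_mul_of_nonneg_right _ (by positivity)
        have : 0 ≤ 16 * √√(2 * R) / √√(c / (2 * K * R)) := by positivity
        linarith
  -- Here `β(u - u') = (βu - β'u') - (β - β')u'` and the first term is less than half the available
  -- size, so the second must exceed the other half.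
  · have h1 : c * |u - u'| ≤ |β * (u - u')| := by
      rw [abs_mul]; gcongr
    have h2 : |(β - β') * u'| ≤ K * |α - α'| * R := by
      rw [abs_mul]; gcongr
    have h3 : |β * (u - u')| ≤ |β * u - β' * u'| + |(β - β') * u'| := by
      have : β * (u - u') = (β * u - β' * u') - (β - β') * u' := by ring
      rw [this]; exact abs_sub _ _
    have h4 : c / (2 * K * R) * |u - u'| ≤ |α - α'| := by
      rw [div_mul_eq_mul_div, div_le_iff₀ (by positivity)]
      nlinarith
    have ht : α - α' ≠ 0 := by
      rw [← abs_pos]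
      exact lt_of_lt_of_le (by positivity) h4
    refine (norm_integral_symm_le_right ht hN).trans ?_
    have hq : 0 < c / (2 * K * R) := by positivity
    have hdd : √√|u - u'| * √√|u - u'| = √|u - u'| := Real.mul_self_sqrt (Real.sqrt_nonneg _)
    have h5 : √√(c / (2 * K * R)) * √√|u - u'| ≤ √√|α - α'| := by
      rw [← Real.sqrt_mul (by positivity), ← Real.sqrt_mul hq.le]
      exact Real.sqrt_le_sqrt (Real.sqrt_le_sqrt h4)
    -- Since `|u - u'| ≤ 2R`, the exponent `-1/4` may be worsened to `-1/2` at the cost of a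
    -- constant.
    have h6 : √√|u - u'| ≤ √√(2 * R) := Real.sqrt_le_sqrt (Real.sqrt_le_sqrt hd2)
    have p1 : 0 < √√(c / (2 * K * R)) := by positivity
    have p2 : 0 < √√|u - u'| := by positivity
    calc 2 * (8 / √√|α - α'|) = 16 / √√|α - α'| := by ring
      _ ≤ 16 / (√√(c / (2 * K * R)) * √√|u - u'|) := by gcongr
      _ = 16 * √√|u - u'| / √√(c / (2 * K * R)) * (1 / √|u - u'|) := by
        have : 1 / √|u - u'| = 1 / √√|u - u'| * (1 / √√|u - u'|) := by
          rw [div_mul_div_comm, hdd, one_mul]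
        rw [this]
        field_simp
      _ ≤ 16 * √√(2 * R) / √√(c / (2 * K * R)) * (1 / √|u - u'|) := by gcongr
      _ ≤ _ := by
        apply mul_le_mul_of_nonneg_right _ (by positivity)
        have : 0 ≤ 44 / √(c / 2) := by positivity
        linarith

theorem integrableOn_one_div_sqrt_abs {a : ℝ} (ha : 0 ≤ a) :
    IntegrableOn (fun s : ℝ => 1 / √|s|) (Set.Icc (-a) a) := by
  rw [← intervalIntegrable_iff_integrableOn_Icc_of_le (by linarith)]
  refine intervalIntegrable_of_even (fun x => by rw [abs_neg]) fun x hx => ?_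
  have h := intervalIntegral.intervalIntegrable_rpow' (a := 0) (b := x) (r := -(1 / 2))
    (by norm_num)
  refine h.congr fun s hs => ?_
  rw [Set.uIoc_of_le hx.le] at hs
  rw [abs_of_pos hs.1, Real.rpow_neg hs.1.le, ← Real.sqrt_eq_rpow, one_div]

/-- The translate `u - u'` stays in `[-2R, 2R]`, which makes the bound uniform in `u`. -/
theorem integral_one_div_sqrt_abs_sub_le {R u : ℝ} (hR : 0 < R) (hu : |u| ≤ R) :
    IntegrableOn (fun u' : ℝ => 1 / √|u - u'|) (Set.Icc (-R) R) ∧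
    ∫ u' in Set.Icc (-R) R, 1 / √|u - u'| ≤ ∫ s in Set.Icc (-(2 * R)) (2 * R), 1 / √|s| := by
  set F : ℝ → ℝ := (Set.Icc (-(2 * R)) (2 * R)).indicator fun s => 1 / √|s| with hF
  have hFi : Integrable F :=
    (integrableOn_one_div_sqrt_abs (by linarith)).integrable_indicator measurableSet_Icc
  have hFu : Integrable fun u' => F (u - u') := hFi.comp_sub_left u
  have hF0 : ∀ s, 0 ≤ F s := fun s => Set.indicator_nonneg (fun _ _ => by positivity) s
  have hu2 := abs_le.1 hu
  have heq : ∀ u' ∈ Set.Icc (-R) R, F (u - u') = 1 / √|u - u'| := fun u' hu' => by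
    have : u - u' ∈ Set.Icc (-(2 * R)) (2 * R) :=
      ⟨by linarith [hu2.1, hu'.2], by linarith [hu2.2, hu'.1]⟩
    rw [hF, Set.indicator_of_mem this]
  refine ⟨hFu.integrableOn.congr_fun heq measurableSet_Icc, ?_⟩
  rw [← setIntegral_congr_fun measurableSet_Icc heq,
    ← integral_indicator (f := fun s : ℝ => 1 / √|s|) measurableSet_Icc, ← hF,
    ← integral_sub_left_eq_self F volume u]
  exact setIntegral_le_integral hFu (Filter.Eventually.of_forall fun _ => hF0 _)

theorem le_norm_sq_mul_inv_weight (g : ℝ → ℂ) (v : ℝ) :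
    ‖g v‖ ^ 2 ≤ ‖g v‖ ^ 2 * (weight v)⁻¹ :=
  le_mul_of_one_le_right (by positivity) ((one_le_inv₀ (weight_pos v)).2 (weight_le_one v))

theorem integrable_restrict_of_weighted {g : ℝ → ℂ} (hg : AEStronglyMeasurable g)
    (hgw : Integrable fun v => ‖g v‖ ^ 2 * (weight v)⁻¹) {s : Set ℝ} (hs : volume s < ⊤) :
    IntegrableOn g s := by
  have h2 : MemLp g 2 := by
    rw [memLp_two_iff_integrable_sq_norm hg]
    refine hgw.mono' (hg.norm.pow 2) (Filter.Eventually.of_forall fun v => ?_)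
    rw [Real.norm_of_nonneg (by positivity)]
    exact le_norm_sq_mul_inv_weight g v
  have : IsFiniteMeasure (volume.restrict s) := ⟨by simpa using hs⟩
  exact (h2.restrict s).integrable one_le_two

/-- The linearised maximal estimate. -/
theorem exists_linearized_bound {R c K : ℝ} (hR : 0 < R) (hc : 0 < c) (hK : 0 < K) :
    ∃ C, 0 < C ∧ ∀ (α β ν : ℝ → ℝ) (N : ℝ), Measurable α → Measurable β → Measurable ν →
      (∀ u, 0 ≤ ν u) → (∀ u, ν u ≤ N) → (∀ u u', |β u - β u'| ≤ K * |α u - α u'|) →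
      (∀ u, c ≤ |β u|) → ∀ g : ℝ → ℂ, AEStronglyMeasurable g →
      Integrable (fun v => ‖g v‖ ^ 2 * (weight v)⁻¹) →
      ∫ u in Set.Icc (-R) R, ‖∫ v in (-ν u)..(ν u), quadExp (β u * u) (α u) v * g v‖ ^ 2 ≤
        C * ∫ v, ‖g v‖ ^ 2 * (weight v)⁻¹ := by
  set D := 44 / √(c / 2) + 16 * √√(2 * R) / √√(c / (2 * K * R)) with hD
  have hDpos : 0 < D := by positivity
  set J := ∫ s in Set.Icc (-(2 * R)) (2 * R), 1 / √|s| with hJ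
  have hJ0 : 0 ≤ J := integral_nonneg fun s => by positivity
  refine ⟨D * J + 1, by positivity, fun α β ν N hα hβ hν h0 hN hαβ hβc g hg hgw => ?_⟩
  have hgi : IntegrableOn g (Set.Ioc (-N) N) :=
    integrable_restrict_of_weighted hg hgw measure_Ioc_lt_top
  have key := integral_norm_sq_integral_kernel_le (μ := volume.restrict (Set.Icc (-R) R))
    (ν := volume.restrict (Set.Ioc (-N) N)) (measurable_truncatedKernel hα hβ hν)
    (norm_truncatedKernel_le α β ν) continuous_weight.measurable weight_pos weight_le_one
    (C := D * J + 1) (by positivity) ?_ hgi hgw.integrableOn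
  · simp only [integral_truncatedKernel_mul (h0 _) (hN _)] at key
    refine key.trans (mul_le_mul_of_nonneg_left ?_ (by positivity))
    exact setIntegral_le_integral hgw (Filter.Eventually.of_forall fun v =>
      mul_nonneg (by positivity) (inv_nonneg.2 (weight_pos v).le))
  · refine (ae_restrict_iff' measurableSet_Icc).2 (Filter.Eventually.of_forall fun u hu => ?_)
    have hu' : |u| ≤ R := abs_le.2 hu
    obtain ⟨hi, hle⟩ := integral_one_div_sqrt_abs_sub_le hR hu'
    refine le_trans ?_ (by linarith : D * J ≤ D * J + 1)
    refine le_trans ?_ (mul_le_mul_of_nonneg_left hle hDpos.le)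
    rw [← integral_const_mul]
    refine integral_mono_of_nonneg (Filter.Eventually.of_forall fun _ => norm_nonneg _)
      (hi.const_mul D) ?_
    -- The kernel estimate fails to cover the diagonal, which is a null set.
    have hne : ∀ᵐ u' ∂(volume.restrict (Set.Icc (-R) R)), u' ≠ u :=
      ae_restrict_of_ae (Measure.ae_ne volume u)
    filter_upwards [hne, ae_restrict_mem measurableSet_Icc] with u' huu hu''
    rw [integral_truncatedKernel_mul_conj (h0 u) (hN u) (h0 u')]
    exact norm_integral_quadExp_sub_mul_weight_le hR hc hK (le_min (h0 u) (h0 u')) hu'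
      (abs_le.2 hu'') huu.symm (hβc u) (hαβ u u')

/-! ### From the linearised to the maximal estimate -/

/-- Finitely many comparisons choose a maximiser measurably. The choice turns a finite maximal
function into a linearised operator. -/
theorem exists_measurable_argmax {X : Type*} [MeasurableSpace X] {F : ℕ → X → ℝ}
    (hF : ∀ k, Measurable (F k)) (n : ℕ) :
    ∃ j : X → ℕ, Measurable j ∧ (∀ x, j x ≤ n) ∧ ∀ x, ∀ k ≤ n, F k x ≤ F (j x) x := by
  induction n with
  | zero =>
    refine ⟨fun _ => 0, measurable_const, fun _ => le_rfl, fun x k hk => ?_⟩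
    rw [Nat.le_zero.1 hk]
  | succ n ih =>
    obtain ⟨j, hj, hjn, hmax⟩ := ih
    have hFj : Measurable fun x => F (j x) x :=
      (measurable_from_prod_countable_left (f := fun p : X × ℕ => F p.2 p.1) hF).comp
        (measurable_id.prodMk hj)
    classical
    refine ⟨fun x => if F (n + 1) x ≤ F (j x) x then j x else n + 1,
      Measurable.ite (measurableSet_le (hF _) hFj) hj measurable_const, fun x => ?_,
      fun x k hk => ?_⟩
    · beta_reduce
      split_ifs
      · exact (hjn x).trans n.le_succ
      · exact le_rfl
    · beta_reduce
      rcases Nat.le_succ_iff.1 hk with hk | rfl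
      · split_ifs with h
        · exact hmax x k hk
        · exact (hmax x k hk).trans (not_le.1 h).le
      · split_ifs with h
        · exact h
        · exact le_rfl

theorem measurable_partialSups {X : Type*} [MeasurableSpace X] {F : ℕ → X → ENNReal}
    (hF : ∀ k, Measurable (F k)) (n : ℕ) : Measurable (partialSups F n) := by
  induction n with
  | zero => simpa using hF 0
  | succ n ih =>
    rw [partialSups_add_one]
    exact ih.sup (hF _)

theorem intervalIntegrable_of_weighted {g : ℝ → ℂ} (hg : AEStronglyMeasurable g)
    (hgw : Integrable fun v => ‖g v‖ ^ 2 * (weight v)⁻¹) (p q : ℝ) :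
    IntervalIntegrable g volume p q :=
  ⟨integrable_restrict_of_weighted hg hgw measure_Ioc_lt_top,
    integrable_restrict_of_weighted hg hgw measure_Ioc_lt_top⟩

theorem intervalIntegrable_quadExp_mul {g : ℝ → ℂ} {p q : ℝ}
    (hg : IntervalIntegrable g volume p q) (x t : ℝ) :
    IntervalIntegrable (fun v => quadExp x t v * g v) volume p q :=
  hg.continuousOn_mul (continuous_quadExp x t).continuousOn

theorem continuous_integral_quadExp_mul {g : ℝ → ℂ} {p q : ℝ}
    (hg : IntervalIntegrable g volume p q) (β a : ℝ) :
    Continuous fun u => ∫ v in p..q, quadExp (β * u) a v * g v := by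
  refine intervalIntegral.continuous_of_dominated_interval (bound := fun v => ‖g v‖)
    (fun u => (intervalIntegrable_quadExp_mul hg _ _).aestronglyMeasurable_restrict_uIoc)
    (fun u => Filter.Eventually.of_forall fun v _ => ?_) hg.norm
    (Filter.Eventually.of_forall fun v _ => ?_)
  · rw [norm_mul, norm_quadExp, one_mul]
  · unfold quadExp; fun_prop

theorem norm_integral_quadExp_mul_le {g : ℝ → ℂ} {m N : ℝ} (hm : 0 ≤ m) (hmN : m ≤ N)
    (hg : IntegrableOn g (Set.Ioc (-N) N)) (x t : ℝ) :
    ‖∫ v in (-m)..m, quadExp x t v * g v‖ ≤ ∫ v in Set.Ioc (-N) N, ‖g v‖ := by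
  have hs : Set.Ioc (-m) m ⊆ Set.Ioc (-N) N := Set.Ioc_subset_Ioc (by linarith) hmN
  rw [intervalIntegral.integral_of_le (by linarith)]
  refine (norm_integral_le_of_norm_le (hg.mono_set hs).norm
    (Filter.Eventually.of_forall fun v => ?_)).trans (setIntegral_mono_set hg.norm
    (Filter.Eventually.of_forall fun v => norm_nonneg _) hs.eventuallyLE)
  rw [norm_mul, norm_quadExp, one_mul]

/-- The maximal estimate over a sequence of parameters and truncations. -/
theorem exists_lintegral_iSup_bound {R c K : ℝ} (hR : 0 < R) (hc : 0 < c) (hK : 0 < K) :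
    ∃ C, 0 < C ∧ ∀ (a β N : ℕ → ℝ), (∀ k, 0 ≤ N k) →
      (∀ k l, |β k - β l| ≤ K * |a k - a l|) → (∀ k, c ≤ |β k|) →
      ∀ g : ℝ → ℂ, AEStronglyMeasurable g → Integrable (fun v => ‖g v‖ ^ 2 * (weight v)⁻¹) →
      ∫⁻ u in Set.Icc (-R) R,
          ⨆ k, ‖∫ v in (-N k)..(N k), quadExp (β k * u) (a k) v * g v‖ₑ ^ 2 ≤
        ENNReal.ofReal (C * ∫ v, ‖g v‖ ^ 2 * (weight v)⁻¹) := by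
  obtain ⟨C, hC0, hC⟩ := exists_linearized_bound hR hc hK
  refine ⟨C, hC0, fun a β N hN hβ hβc g hg hgw => ?_⟩
  set T : ℕ → ℝ → ℂ := fun k u => ∫ v in (-N k)..(N k), quadExp (β k * u) (a k) v * g v with hT
  have hTm : ∀ k, Measurable (T k) := fun k =>
    (continuous_integral_quadExp_mul (intervalIntegrable_of_weighted hg hgw _ _) _ _).measurable
  have hTe : ∀ k, Measurable fun u => ‖T k u‖ₑ ^ 2 := fun k => (hTm k).enorm.pow_const 2
  have hsup : ∀ u, ⨆ k, ‖T k u‖ₑ ^ 2 = ⨆ n, partialSups (fun k u => ‖T k u‖ₑ ^ 2) n u := fun u => by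
    rw [← iSup_apply (f := fun n => partialSups (fun k u => ‖T k u‖ₑ ^ 2) n), iSup_partialSups_eq,
      iSup_apply]
  change ∫⁻ u in Set.Icc (-R) R, ⨆ k, ‖T k u‖ₑ ^ 2 ≤ _
  simp_rw [hsup]
  -- Monotone convergence reduces the claim to finitely many indices, with a constant independent of
  -- their number.
  rw [lintegral_iSup (measurable_partialSups hTe) (partialSups _).monotone]
  refine iSup_le fun n => ?_
  obtain ⟨j, hj, hjn, hmax⟩ := exists_measurable_argmax (fun k => (hTm k).norm) n
  have hTj : Measurable fun u => T (j u) u :=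
    (measurable_from_prod_countable_left (f := fun p : ℝ × ℕ => T p.2 p.1) hTm).comp
      (measurable_id.prodMk hj)
  -- Any common bound for the chosen truncations would do, as the linearised constant does not
  -- depend on it.
  set M := ∑ k ∈ Finset.range (n + 1), N k with hM
  have hNM : ∀ u, N (j u) ≤ M := fun u =>
    Finset.single_le_sum (f := N) (fun k _ => hN k)
      (Finset.mem_range.2 (Nat.lt_succ_of_le (hjn u)))
  have hlin := hC (fun u => a (j u)) (fun u => β (j u)) (fun u => N (j u)) M
    (measurable_from_nat.comp hj) (measurable_from_nat.comp hj) (measurable_from_nat.comp hj)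
    (fun u => hN _) hNM (fun u u' => hβ _ _) (fun u => hβc _) g hg hgw
  have hint : Integrable (fun u => ‖T (j u) u‖ ^ 2) (volume.restrict (Set.Icc (-R) R)) := by
    refine Integrable.of_bound (hTj.norm.pow_const 2).aestronglyMeasurable
      ((∫ v in Set.Ioc (-M) M, ‖g v‖) ^ 2) (Filter.Eventually.of_forall fun u => ?_)
    rw [Real.norm_of_nonneg (by positivity)]
    have := norm_integral_quadExp_mul_le (hN (j u)) (hNM u)
      (integrable_restrict_of_weighted hg hgw measure_Ioc_lt_top) (β (j u) * u) (a (j u))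
    exact pow_le_pow_left₀ (norm_nonneg _) this 2
  refine le_trans (lintegral_mono fun u => ?_) (le_trans
    (ofReal_integral_eq_lintegral_ofReal hint
      (Filter.Eventually.of_forall fun u => by positivity)).ge (ENNReal.ofReal_le_ofReal hlin))
  have hle : partialSups (fun k u => ‖T k u‖ₑ ^ 2) n ≤ fun u => ENNReal.ofReal (‖T (j u) u‖ ^ 2) := by
    refine partialSups_le _ _ _ fun k hk u => ?_
    beta_reduce
    rw [← ofReal_norm, ← ENNReal.ofReal_pow (norm_nonneg _)]
    exact ENNReal.ofReal_le_ofReal (pow_le_pow_left₀ (norm_nonneg _) (hmax u k hk) 2)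
  exact hle u

/-! ### Uniform convergence almost everywhere -/

/-- Joint continuity in the parameter and the truncation lets a countable dense set of pairs control
all of them. -/
theorem continuous_integral_parametric_symm {X : Type*} [TopologicalSpace X]
    [FirstCountableTopology X] {x t : X → ℝ} (hx : Continuous x) (ht : Continuous t) {g : ℝ → ℂ}
    (hg : ∀ p q, IntervalIntegrable g volume p q) :
    Continuous fun p : X × ℝ => ∫ v in (-p.2)..p.2, quadExp (x p.1) (t p.1) v * g v := by
  have h : Continuous fun p : X × ℝ => ∫ v in (0 : ℝ)..p.2, quadExp (x p.1) (t p.1) v * g v := by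
    refine continuous_iff_continuousAt.2 fun ⟨y, N⟩ => ?_
    refine intervalIntegral.continuousAt_parametric_primitive_of_dominated
      (F := fun y v => quadExp (x y) (t y) v * g v) (fun v => ‖g v‖) (-(|N| + 1)) (|N| + 1)
      (fun y => (intervalIntegrable_quadExp_mul (hg _ _) _ _).aestronglyMeasurable_restrict_uIoc)
      (Filter.Eventually.of_forall fun y => Filter.Eventually.of_forall fun v => ?_) (hg _ _).norm
      (Filter.Eventually.of_forall fun v => ?_) ?_ ?_ (by simp)
    · rw [norm_mul, norm_quadExp, one_mul]
    · exact Continuous.continuousAt (by unfold quadExp; fun_prop)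
    · constructor <;> linarith [abs_nonneg N]
    · constructor <;> linarith [neg_abs_le N, le_abs_self N]
  have h' := h.sub (h.comp (continuous_fst.prodMk continuous_snd.neg))
  refine h'.congr fun p => ?_
  exact intervalIntegral.integral_interval_sub_left
    (intervalIntegrable_quadExp_mul (hg _ _) _ _) (intervalIntegrable_quadExp_mul (hg _ _) _ _)

/-- This turns the difference of two truncations into one truncated integral of a high-frequency
density, to which the maximal estimate applies. -/
theorem integral_mul_indicator_compl_Ioc {F g : ℝ → ℂ}
    (hg : ∀ p q, IntervalIntegrable (fun v => F v * g v) volume p q) {m N : ℝ} (hm : 0 ≤ m)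
    (hmN : m ≤ N) :
    ∫ v in (-N)..N, F v * (Set.Ioc (-m) m)ᶜ.indicator g v =
      (∫ v in (-N)..N, F v * g v) - ∫ v in (-m)..m, F v * g v := by
  have hN : -N ≤ N := by linarith
  rw [← setIntegral_indicator_Ioc_symm hm hmN, intervalIntegral.integral_of_le hN,
    intervalIntegral.integral_of_le hN, ← integral_sub (hg _ _).1
      ((hg _ _).1.indicator measurableSet_Ioc)]
  congr 1 with v
  rw [Set.indicator_compl, Set.indicator_mul_right]
  simp [mul_sub]

theorem tendsto_integral_indicator_compl_Ioc {g : ℝ → ℂ} (hg : AEStronglyMeasurable g)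
    (hgw : Integrable fun v => ‖g v‖ ^ 2 * (weight v)⁻¹) :
    Tendsto (fun m : ℕ => ∫ v, ‖(Set.Ioc (-(m : ℝ)) m)ᶜ.indicator g v‖ ^ 2 * (weight v)⁻¹)
      atTop (𝓝 0) := by
  have h := tendsto_integral_of_dominated_convergence (μ := volume) (f := fun _ => (0 : ℝ))
    (F := fun (m : ℕ) v => ‖(Set.Ioc (-(m : ℝ)) m)ᶜ.indicator g v‖ ^ 2 * (weight v)⁻¹)
    (fun v => ‖g v‖ ^ 2 * (weight v)⁻¹) (fun m => ?_) hgw (fun m => ?_) ?_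
  · simpa using h
  · exact ((hg.indicator measurableSet_Ioc.compl).norm.pow 2).mul
      (continuous_weight.measurable.inv).aestronglyMeasurable
  · refine Filter.Eventually.of_forall fun v => ?_
    have hw := inv_nonneg.2 (weight_pos v).le
    rw [Real.norm_of_nonneg (mul_nonneg (by positivity) hw)]
    exact mul_le_mul_of_nonneg_right (pow_le_pow_left₀ (norm_nonneg _)
      (norm_indicator_le_norm_self _ _) 2) hw
  · refine Filter.Eventually.of_forall fun v => tendsto_const_nhds.congr' ?_
    obtain ⟨n, hn⟩ := exists_nat_gt |v|
    filter_upwards [eventually_ge_atTop n] with m hm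
    have hm' : |v| < m := hn.trans_le (by exact_mod_cast hm)
    have hv : v ∉ (Set.Ioc (-(m : ℝ)) m)ᶜ := by
      rw [Set.notMem_compl_iff]
      exact ⟨(abs_lt.1 hm').1, (abs_lt.1 hm').2.le⟩
    rw [Set.indicator_of_notMem hv]
    simp

/-- Almost everywhere, the truncated integrals are Cauchy uniformly in the parameter. -/
theorem ae_uniform_tail_le {R c K : ℝ} (hR : 0 < R) (hc : 0 < c) (hK : 0 < K) {b : ℝ → ℝ}
    {V : Set ℝ} (hV : V.Nonempty) (hbV : ∀ x ∈ V, ∀ y ∈ V, |b x - b y| ≤ K * |x - y|)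
    (hbc : ∀ x ∈ V, c ≤ |b x|) (hcont : ContinuousOn b V) {g : ℝ → ℂ}
    (hg : AEStronglyMeasurable g) (hgw : Integrable fun v => ‖g v‖ ^ 2 * (weight v)⁻¹) :
    ∀ᵐ u ∂(volume.restrict (Set.Icc (-R) R)), ∀ ε > 0, ∃ m : ℕ, ∀ a ∈ V, ∀ N : ℝ, m ≤ N →
      ‖(∫ v in (-N)..N, quadExp (b a * u) a v * g v) -
        ∫ v in (-(m : ℝ))..m, quadExp (b a * u) a v * g v‖ < ε := by
  obtain ⟨C, hC0, hC⟩ := exists_lintegral_iSup_bound hR hc hK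
  have : Nonempty V := hV.to_subtype
  set z : ℕ → V × NNReal := TopologicalSpace.denseSeq (V × NNReal) with hz
  set G : ℕ → ℝ → ℂ := fun m => (Set.Ioc (-(m : ℝ)) m)ᶜ.indicator g with hG
  have hGm : ∀ m, AEStronglyMeasurable (G m) := fun m => hg.indicator measurableSet_Ioc.compl
  have hGw : ∀ m, Integrable fun v => ‖G m v‖ ^ 2 * (weight v)⁻¹ := fun m => by
    have := hgw.indicator (measurableSet_Ioc (a := -(m : ℝ)) (b := m)).compl
    refine this.congr (Filter.Eventually.of_forall fun v => ?_)
    by_cases hv : v ∈ (Set.Ioc (-(m : ℝ)) m)ᶜ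
    · simp only [hG, Set.indicator_of_mem hv]
    · simp [hG, Set.indicator_of_notMem hv]
  have hGi : ∀ m p q, IntervalIntegrable (G m) volume p q := fun m =>
    intervalIntegrable_of_weighted (hGm m) (hGw m)
  set F : ℕ → ℝ → V × NNReal → ℂ := fun m u x =>
    ∫ v in (-(x.2 : ℝ))..x.2, quadExp (b x.1 * u) x.1 v * G m v with hF
  set M : ℕ → ℝ → ENNReal := fun m u => ⨆ k, ‖F m u (z k)‖ₑ ^ 2 with hM
  have hMm : ∀ m, Measurable (M m) := fun m => by
    refine Measurable.iSup fun k => Measurable.pow_const (Measurable.enorm ?_) 2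
    exact (continuous_integral_quadExp_mul (hGi m _ _) _ _).measurable
  have hMle : ∀ m, ∫⁻ u in Set.Icc (-R) R, M m u ≤
      ENNReal.ofReal (C * ∫ v, ‖G m v‖ ^ 2 * (weight v)⁻¹) := fun m =>
    hC (fun k => (z k).1) (fun k => b (z k).1) (fun k => (z k).2) (fun k => (z k).2.2)
      (fun k l => hbV _ (z k).1.2 _ (z l).1.2) (fun k => hbc _ (z k).1.2) (G m) (hGm m) (hGw m)
  have hlim : Tendsto (fun m => ENNReal.ofReal (C * ∫ v, ‖G m v‖ ^ 2 * (weight v)⁻¹)) atTop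
      (𝓝 0) := by
    have := (tendsto_integral_indicator_compl_Ioc hg hgw).const_mul C
    rw [mul_zero] at this
    simpa using ENNReal.tendsto_ofReal this
  -- Fatou's lemma. A vanishing lower limit is enough, since each `ε` needs only one `m`.
  have hzero : ∫⁻ u in Set.Icc (-R) R, liminf (fun m => M m u) atTop = 0 := by
    refine le_antisymm ((lintegral_liminf_le hMm).trans ?_) zero_le
    rw [← hlim.liminf_eq]
    exact liminf_le_liminf (Filter.Eventually.of_forall hMle)
  rw [lintegral_eq_zero_iff (Measurable.liminf hMm)] at hzero
  filter_upwards [hzero] with u hu ε hε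
  have hfreq : ∃ᶠ m in atTop, M m u < ENNReal.ofReal (ε ^ 2) :=
    frequently_lt_of_liminf_lt (by isBoundedDefault)
      (by rw [hu]; exact ENNReal.ofReal_pos.2 (by positivity))
  obtain ⟨m, hm⟩ := hfreq.exists
  refine ⟨m, fun a ha N hN => ?_⟩
  have hN0 : 0 ≤ N := m.cast_nonneg.trans hN
  have hFc : Continuous (F m u) := by
    have hb' : Continuous fun x : V => b x * u :=
      (continuousOn_iff_continuous_domRestrict.1 hcont).mul continuous_const
    exact (continuous_integral_parametric_symm hb' continuous_subtype_val (hGi m)).comp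
      (continuous_fst.prodMk (NNReal.continuous_coe.comp continuous_snd))
  -- Continuity carries the bound from the dense sequence to all parameters and truncations.
  have hall : ∀ x, ‖F m u x‖ₑ ^ 2 ≤ M m u := by
    refine isClosed_property (TopologicalSpace.denseRange_denseSeq (V × NNReal)) ?_ fun k =>
      le_iSup (fun k => ‖F m u (z k)‖ₑ ^ 2) k
    exact isClosed_le ((ENNReal.continuous_pow 2).comp hFc.enorm) continuous_const
  have hlt := (hall (⟨a, ha⟩, ⟨N, hN0⟩)).trans_lt hm
  rw [← ofReal_norm, ← ENNReal.ofReal_pow (norm_nonneg _),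
    ENNReal.ofReal_lt_ofReal_iff (by positivity)] at hlt
  have hlt' := lt_of_pow_lt_pow_left₀ 2 hε.le hlt
  have heq := integral_mul_indicator_compl_Ioc (F := quadExp (b a * u) a) (g := g) (fun p q =>
    intervalIntegrable_quadExp_mul (intervalIntegrable_of_weighted hg hgw p q) _ _)
    m.cast_nonneg hN
  rw [← heq]
  exact hlt'

/-- Functions that are Cauchy at infinity uniformly on a neighbourhood, and continuous there, have
limits that depend continuously on the parameter. -/
theorem tendsto_limUnder_of_uniform_cauchy {T : ℝ → ℝ → ℂ} {V : Set ℝ} {a₀ : ℝ} (hV : V ∈ 𝓝 a₀)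
    (hT : ∀ N, 0 ≤ N → ContinuousOn (fun a => T a N) V)
    (h : ∀ ε > 0, ∃ m : ℕ, ∀ a ∈ V, ∀ N : ℝ, m ≤ N → ‖T a N - T a m‖ < ε) :
    (∀ a ∈ V, Tendsto (T a) atTop (𝓝 (limUnder atTop (T a)))) ∧
      ContinuousAt (fun a => limUnder atTop (T a)) a₀ := by
  have hcauchy : ∀ a ∈ V, CauchySeq (T a) := fun a ha => by
    rw [Metric.cauchySeq_iff']
    intro ε hε
    obtain ⟨m, hm⟩ := h ε hε
    exact ⟨m, fun N hN => by rw [dist_eq_norm]; exact hm a ha N hN⟩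
  have hlim : ∀ a ∈ V, Tendsto (T a) atTop (𝓝 (limUnder atTop (T a))) := fun a ha =>
    (hcauchy a ha).tendsto_limUnder
  refine ⟨hlim, ?_⟩
  have hunif : TendstoUniformlyOn (fun (m : ℝ) a => T a m) (fun a => limUnder atTop (T a))
      atTop V := by
    refine UniformCauchySeqOn.tendstoUniformlyOn_of_tendsto ?_ hlim
    rw [Metric.uniformCauchySeqOn_iff]
    intro ε hε
    obtain ⟨m, hm⟩ := h (ε / 2) (half_pos hε)
    refine ⟨m, fun N hN N' hN' a ha => ?_⟩
    have h1 := hm a ha N hN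
    have h2 := hm a ha N' hN'
    rw [← dist_eq_norm] at h1 h2
    exact (dist_triangle_right _ _ (T a m)).trans_lt (by linarith)
  have hco : ContinuousOn (fun a => limUnder atTop (T a)) V :=
    hunif.continuousOn ((eventually_ge_atTop 0).mono hT).frequently
  exact hco.continuousAt hV

/-- Almost everywhere convergence for densities with finite weighted norm. -/
theorem ae_tendsto_limUnder {K : NNReal} {b : ℝ → ℝ} {a₀ : ℝ} {U : Set ℝ} (hU : U ∈ 𝓝 a₀)
    (hb : LipschitzOnWith K b U) (hb₀ : b a₀ ≠ 0) {g : ℝ → ℂ} (hg : AEStronglyMeasurable g)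
    (hgw : Integrable fun v => ‖g v‖ ^ 2 * (weight v)⁻¹) :
    ∀ᵐ u : ℝ,
      (∀ᶠ a in 𝓝 a₀, Tendsto (fun N : ℝ => ∫ v in (-N)..N, quadExp (b a * u) a v * g v) atTop
        (𝓝 (limUnder atTop fun N : ℝ => ∫ v in (-N)..N, quadExp (b a * u) a v * g v))) ∧
      ContinuousAt (fun a => limUnder atTop fun N : ℝ =>
        ∫ v in (-N)..N, quadExp (b a * u) a v * g v) a₀ := by
  have hc : 0 < |b a₀| / 2 := by have := abs_pos.2 hb₀; positivity
  have hcontU := hb.continuousOn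
  have hev : ∀ᶠ a in 𝓝 a₀, |b a₀| / 2 < |b a| :=
    (hcontU.continuousAt hU).abs.eventually (lt_mem_nhds (half_lt_self (abs_pos.2 hb₀)))
  set V : Set ℝ := U ∩ {a | |b a₀| / 2 < |b a|} with hVdef
  have hV : V ∈ 𝓝 a₀ := inter_mem hU hev
  have hcont : ContinuousOn b V := hcontU.mono Set.inter_subset_left
  -- The constant `K + 1` is positive even when `K = 0`.
  have hlip : ∀ x ∈ V, ∀ y ∈ V, |b x - b y| ≤ (K + 1 : ℝ) * |x - y| := fun x hx y hy => by
    have := hb.dist_le_mul x hx.1 y hy.1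
    rw [Real.dist_eq, Real.dist_eq] at this
    nlinarith [abs_nonneg (x - y)]
  -- Countably many bounded intervals exhaust the line; the radius `n + 1` is positive also for `n =
  -- 0`.
  have hae : ∀ n : ℕ, ∀ᵐ u : ℝ, u ∈ Set.Icc (-((n : ℝ) + 1)) (n + 1) → ∀ ε > 0, ∃ m : ℕ,
      ∀ a ∈ V, ∀ N : ℝ, m ≤ N → ‖(∫ v in (-N)..N, quadExp (b a * u) a v * g v) -
        ∫ v in (-(m : ℝ))..m, quadExp (b a * u) a v * g v‖ < ε := fun n =>
    (ae_restrict_iff' measurableSet_Icc).1 (ae_uniform_tail_le (by positivity) hc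
      (by positivity) ⟨a₀, mem_of_mem_nhds hV⟩ hlip (fun x hx => hx.2.le) hcont hg hgw)
  filter_upwards [ae_all_iff.2 hae] with u hu
  obtain ⟨n, hn⟩ := exists_nat_gt |u|
  have hu' := hu n (abs_le.1 (by linarith))
  have hT : ∀ N : ℝ, 0 ≤ N →
      ContinuousOn (fun a => ∫ v in (-N)..N, quadExp (b a * u) a v * g v) V := fun N _ => by
    rw [continuousOn_iff_continuous_domRestrict]
    have hb' : Continuous fun x : V => b x * u :=
      (continuousOn_iff_continuous_domRestrict.1 hcont).mul continuous_const
    exact (continuous_integral_parametric_symm hb' continuous_subtype_val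
      (intervalIntegrable_of_weighted hg hgw)).comp
        (continuous_id.prodMk (continuous_const (y := N)))
  obtain ⟨h1, h2⟩ := tendsto_limUnder_of_uniform_cauchy hV hT hu'
  exact ⟨Filter.mem_of_superset hV h1, h2⟩

/-! ### Sobolev regularity as a weighted bound, and the conclusion -/

theorem Lp_toTemperedDistribution_injective :
    Function.Injective fun f : Lp ℂ 2 (volume : Measure ℝ) =>
      (Lp.toTemperedDistribution f : 𝓢'(ℝ, ℂ)) := by
  have h := Lp.ker_toTemperedDistributionCLM_eq_bot (F := ℂ) (μ := (volume : Measure ℝ)) (p := 2)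
  exact LinearMap.ker_eq_bot.1 h

/-- The Fourier transform of an `H^s` function, multiplied by `(1 + v²)^(s/2)`, is square
integrable. -/
theorem memLp_fourier_of_memSobolev {s : ℝ} {f : Lp ℂ 2 (volume : Measure ℝ)}
    (hf : TemperedDistribution.MemSobolev s 2 (Lp.toTemperedDistribution f : 𝓢'(ℝ, ℂ)))
    (hs : 0 ≤ s) :
    MemLp (fun v : ℝ => (((1 + ‖v‖ ^ 2) ^ (s / 2) : ℝ) : ℂ) *
      (𝓕 f : Lp ℂ 2 (volume : Measure ℝ)) v) 2 := by
  obtain ⟨f', hf'⟩ := TemperedDistribution.memSobolev_iff_exists_smulLeftCLM_fourier.1 hf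
  set w : ℝ → ℂ := fun v => (((1 + ‖v‖ ^ 2) ^ (s / 2) : ℝ) : ℂ) with hw
  set w' : ℝ → ℂ := fun v => (((1 + ‖v‖ ^ 2) ^ (-s / 2) : ℝ) : ℂ) with hw'
  have hwg : w.HasTemperateGrowth := by fun_prop
  have hwg' : w'.HasTemperateGrowth := by fun_prop
  have hww : w * w' = fun _ => (1 : ℂ) := by
    ext v
    simp only [hw, hw', Pi.mul_apply]
    rw [← Complex.ofReal_mul, ← Real.rpow_add (by positivity), neg_div, add_neg_cancel,
      Real.rpow_zero, Complex.ofReal_one]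
  have hbd : ∀ v, ‖w' v‖ ≤ 1 := fun v => by
    rw [Complex.norm_real, Real.norm_of_nonneg (by positivity)]
    exact Real.rpow_le_one_of_one_le_of_nonpos (by simp [sq_nonneg]) (by linarith)
  have hmem : MemLp w' ⊤ (volume : Measure ℝ) :=
    memLp_top_of_bound hwg'.1.continuous.aestronglyMeasurable 1 (Filter.Eventually.of_forall hbd)
  -- As a distribution `f'` is `w` times the Fourier transform of `f`. For `s ≥ 0` the inverse `w'`
  -- is bounded, so multiplying by it stays in `L²`, where distributional equality gives equality.
  have key : ((hmem.toLp w' : Lp ℂ ⊤ (volume : Measure ℝ)) • f' : Lp ℂ 2 (volume : Measure ℝ)) =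
      𝓕 f := by
    apply Lp_toTemperedDistribution_injective
    beta_reduce
    rw [Lp.toTemperedDistribution_smul_eq hwg', ← hf',
      TemperedDistribution.smulLeftCLM_smulLeftCLM_apply hwg hwg', hww,
      TemperedDistribution.smulLeftCLM_const, one_smul, Lp.fourier_toTemperedDistribution_eq]
  refine (Lp.memLp f').ae_eq ?_
  rw [← key]
  filter_upwards [Lp.coeFn_lpSMul (r := 2) (hmem.toLp w') f', hmem.coeFn_toLp] with v h1 h2
  have h3 := congrFun hww v
  simp only [Pi.mul_apply] at h3
  rw [h1, Pi.smul_apply', h2, smul_eq_mul, ← mul_assoc]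
  change _ = w v * w' v * _
  rw [h3, one_mul]

/-- With `x = v / (2π)` the squared power is `(1 + x²)^(1/4)`, so the claim reduces to `1 + 2π|x| ≤
16 √(1 + x²)`, which follows from `π < 4`; the factor `4` is `√16`. -/
theorem inv_weight_le (v : ℝ) :
    (weight v)⁻¹ ≤ 4 * ((1 + ‖v / (2 * Real.pi)‖ ^ 2) ^ ((1 / 4 : ℝ) / 2)) ^ 2 := by
  set x := v / (2 * Real.pi) with hx
  have hpi := Real.pi_pos
  have hv : |v| = 2 * Real.pi * |x| := by
    rw [hx, abs_div, abs_of_pos (by positivity : 0 < 2 * Real.pi)]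
    field_simp
  have h4 : ((1 + ‖x‖ ^ 2) ^ ((1 / 4 : ℝ) / 2)) ^ 2 = √√(1 + ‖x‖ ^ 2) := by
    rw [Real.sqrt_eq_rpow, Real.sqrt_eq_rpow, ← Real.rpow_natCast, ← Real.rpow_mul (by positivity),
      ← Real.rpow_mul (by positivity)]
    norm_num
  rw [h4, weight, inv_inv, hv, Real.norm_eq_abs]
  have h5 : (4 : ℝ) * √√(1 + |x| ^ 2) = √(16 * √(1 + |x| ^ 2)) := by
    rw [Real.sqrt_mul (by norm_num)]
    congr 1
    rw [show (16 : ℝ) = 4 ^ 2 by norm_num, Real.sqrt_sq (by norm_num)]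
  rw [h5]
  apply Real.sqrt_le_sqrt
  have h6 : |x| ≤ √(1 + |x| ^ 2) := Real.le_sqrt_of_sq_le (by linarith)
  have h7 : 1 ≤ √(1 + |x| ^ 2) := Real.one_le_sqrt.2 (by nlinarith [sq_nonneg |x|])
  nlinarith [Real.pi_lt_four, abs_nonneg x]

theorem aestronglyMeasurable_angularFourier (f : Lp ℂ 2 (volume : Measure ℝ)) :
    AEStronglyMeasurable (angularFourier f) := by
  have hq : Measure.QuasiMeasurePreserving (fun v : ℝ => v / (2 * Real.pi)) := by
    refine ⟨by fun_prop, ?_⟩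
    simp only [div_eq_mul_inv]
    rw [Real.map_volume_mul_right (by positivity)]
    exact Measure.smul_absolutelyContinuous
  exact ((Lp.aestronglyMeasurable _).comp_quasiMeasurePreserving hq).const_mul _

theorem integrable_angularFourier_weighted {s : ℝ} (hs : 1 / 4 ≤ s)
    {f : Lp ℂ 2 (volume : Measure ℝ)}
    (hf : TemperedDistribution.MemSobolev s 2 (Lp.toTemperedDistribution f : 𝓢'(ℝ, ℂ))) :
    Integrable fun v => ‖angularFourier f v‖ ^ 2 * (weight v)⁻¹ := by
  -- Sobolev spaces decrease in `s`, so only the exponent `1/4` is needed.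
  have hmem := memLp_fourier_of_memSobolev (hf.mono hs) (by norm_num)
  have hint := (memLp_two_iff_integrable_sq_norm hmem.1).1 hmem
  have hint' := (hint.comp_div (by positivity : 2 * Real.pi ≠ 0)).const_mul
    (4 * ‖((Real.sqrt (2 * Real.pi) : ℝ) : ℂ)⁻¹‖ ^ 2)
  refine hint'.mono' (((aestronglyMeasurable_angularFourier f).norm.pow 2).mul
    continuous_weight.measurable.inv.aestronglyMeasurable) (Filter.Eventually.of_forall fun v => ?_)
  rw [Real.norm_of_nonneg (mul_nonneg (by positivity) (inv_nonneg.2 (weight_pos v).le)),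
    angularFourier, norm_mul, norm_mul, Complex.norm_real, Real.norm_of_nonneg (by positivity)]
  have h := inv_weight_le v
  generalize (1 + ‖v / (2 * Real.pi)‖ ^ 2) ^ ((1 / 4 : ℝ) / 2) = W at h ⊢
  refine (mul_le_mul_of_nonneg_left h (by positivity)).trans_eq ?_
  ring

theorem propositiona (b : ℝ → ℝ) (a₀ : ℝ)
    (hb : ∃ K : NNReal, ∃ U ∈ 𝓝 a₀, LipschitzOnWith K b U) (hb₀ : b a₀ ≠ 0)
    (s : ℝ) (hs : 1 / 4 ≤ s)
    (f : Lp ℂ 2 (volume : Measure ℝ))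
    (hf : TemperedDistribution.MemSobolev s 2 (Lp.toTemperedDistribution f : 𝓢'(ℝ, ℂ))) :
    ∀ᵐ u : ℝ ∂volume,
      (∀ᶠ a in 𝓝 a₀,
        Tendsto (fun N : ℝ => truncatedL b f a u N) atTop (𝓝 (operatorL b f a u))) ∧
      Tendsto (fun a : ℝ => operatorL b f a u) (𝓝[≠] a₀) (𝓝 (operatorL b f a₀ u)) := by
  obtain ⟨K, U, hU, hbU⟩ := hb
  -- The normalising constant is moved into the density, so that limits need not be rescaled.
  set c : ℂ := ((Real.sqrt (2 * Real.pi) : ℝ) : ℂ)⁻¹ with hc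
  have hg := (aestronglyMeasurable_angularFourier f).const_mul c
  have hgw : Integrable fun v => ‖c * angularFourier f v‖ ^ 2 * (weight v)⁻¹ := by
    refine ((integrable_angularFourier_weighted hs hf).const_mul (‖c‖ ^ 2)).congr
      (Filter.Eventually.of_forall fun v => ?_)
    simp only [norm_mul]
    ring
  have htr : ∀ a u N, ∫ v in (-N)..N, quadExp (b a * u) a v * (c * angularFourier f v) =
      truncatedL b f a u N := fun a u N => by
    rw [truncatedL, ← hc, ← intervalIntegral.integral_const_mul]
    congr 1 with v
    rw [quadExp]
    ring
  filter_upwards [ae_tendsto_limUnder hU hbU hb₀ hg hgw] with u hu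
  simp only [htr] at hu
  exact ⟨hu.1, hu.2.mono_left nhdsWithin_le_nhds⟩
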